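/- **Notation.** For a set $A$ in a Euclidean space, let $\mathcal P(A)$ be the set of Borel probability measures on $A$. For a Borel measurable $f\ge 0$ with values in $[0,\infty]$ put $$\mathcal E_f(\mu)=\iint f(x-y)\,\mu(dx)\,\mu(dy)\quad(\mu\in\mathcal P(A)),\qquad \mathcal C_f(A)=\Big[\inf_{\mu\in\mathcal P(A)}\mathcal E_f(\mu)\Big]^{-1}\in[0,\infty],$$ with $1/\infty=0$, $1/0=\infty$ and $\inf\emptyset=\infty$. For $\beta>0$ write $\mathcal C_\beta$ for $\mathcal C_f$ with $f=\|\cdot\|^{-\beta}$ (equal to $\infty$ at $0$). Let $X=(X(t))_{t\ge0}$ be a Lévy process in $\mathbb R^d$ (with $X(0)=0$ a.s. and càdlàg paths a.s.) with Lévy exponent $\Psi$, i.e. $E\,e^{i\langle\xi,X(t)\rangle}=e^{-t\Psi(\xi)}$ for all $\xi\in\mathbb R^d$, $t\ge0$. For $x\in\mathbb R$ and $\xi\in\mathbb R^d$ let $\chi_\xi(x)=e^{-|x|\Psi(\operatorname{sign}(x)\xi)}$, let $(\Re\chi_\xi)_+=\max\{\Re\chi_\xi,0\}$ and $(\Re\chi_\xi)_-=\max\{-\Re\chi_\xi,0\}$,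 and for $\gamma\in(0,d)$ let $$g_{\gamma,\pm}(x)=\int_{\mathbb R^d}(\Re\chi_\xi(x))_\pm\,\|\xi\|^{-\gamma}\,d\xi\in[0,\infty].$$ **Theorem 2.1.** For every Lévy process $X$ in $\mathbb R^d$ with Lévy exponent $\Psi$, every Borel set $G\subset\mathbb R_+$ and every $\beta\in(0,d)$: - (a) $\mathcal C_{g_{d-\beta,+}}(G)>0$ implies $\mathcal C_{g_{d-\beta,-}}(G)>0$. - (b) $\mathcal C_{g_{d-\beta,-}}(G)=0$ implies $\mathcal C_{g_{d-\beta,+}}(G)=0$. - (c) If $\mathcal C_\beta(X(G))=0$ almost surely, then $\mathcal C_{g_{d-\beta,+}}(G)=0$. - (e) If $\mathcal C_{g_{d-\beta,+}}(G)=0$ and $\int_{\mathbb R^d}\mathcal E_{(\Re\chi_\xi)_-}(\mu)\,\|\xi\|^{\beta-d}\,d\xi<\infty$ for every $\mu\in\mathcal P(G)$, then $\mathcal C_\beta(X(G))=0$ almost surely. Moreover: - (d) The converse of (c) fails in general: in dimension $d=1$ the deterministic process $X(t)=t$ is a Lévy process with exponent $\Psi(\xi)=-i\xi$, and for $G=[0,1]$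 and every $\beta\in(0,1)$ one has $\mathcal C_{g_{1-\beta,+}}(G)=0$, but it is not true that $\mathcal C_\beta(X(G))=0$ almost surely. -/

import Mathlib

open MeasureTheory ProbabilityTheory Filter Topology Set
open scoped NNReal ENNReal

noncomputable section

/-- `P(A)`: the Borel probability measures on `A`, viewed as measures on the ambient space which
are carried by `A` (the outer measure of the complement is zero, so `A` may be any set; images of
Borel sets under càdlàg paths are analytic, hence universally measurable). On Euclidean
spaces every such measure is regular. -/
def probOn {E : Type*} [MeasurableSpace E] (A : Set E) : Set (Measure E) :=
  {μ | IsProbabilityMeasure μ ∧ μ Aᶜ = 0}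

/-- The `f`-energy `∬ f (x - y) μ(dx) μ(dy)`. The measures `μ` used below are carried by the set
under consideration, so integrating over the whole space or over that set is the same. -/
def fEnergy {E : Type*} [MeasurableSpace E] [Sub E] (f : E → ℝ≥0∞) (μ : Measure E) : ℝ≥0∞ :=
  ∫⁻ x, ∫⁻ y, f (x - y) ∂μ ∂μ

/-- The `f`-capacity `[inf_{μ ∈ P(A)} E_f(μ)]⁻¹` in `[0, ∞]`, with `1/∞ = 0` and `1/0 = ∞`. -/
def fCapacity {E : Type*} [MeasurableSpace E] [Sub E] (f : E → ℝ≥0∞) (A : Set E) : ℝ≥0∞ :=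
  (⨅ μ ∈ probOn A, fEnergy f μ)⁻¹

/-- The Bessel–Riesz capacity `C_β`, with gauge `‖x‖ ^ (-β)`; for `β > 0` the gauge is `∞` at
`x = 0`. -/
def rieszCapacity {d : ℕ} (β : ℝ) (A : Set (EuclideanSpace ℝ (Fin d))) : ℝ≥0∞ :=
  fCapacity (fun x => ‖x‖ₑ ^ (-β)) A

/-- `X` is a Lévy process in `ℝ^d` on the probability space `(Ω, P)`. -/
structure IsLevyProcess {d : ℕ} {Ω : Type*} [MeasurableSpace Ω]
    (X : ℝ≥0 → Ω → EuclideanSpace ℝ (Fin d)) (P : Measure Ω) : Prop where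
  measurable : ∀ t, Measurable (X t)
  zero : ∀ᵐ ω ∂P, X 0 ω = 0
  indep_increments : HasIndepIncrements X P
  stationary_increments : ∀ s t : ℝ≥0, IdentDistrib (fun ω => X (s + t) ω - X s ω) (X t) P P
  stochastically_continuous : ∀ t, TendstoInMeasure P X (𝓝 t) (X t)
  cadlag : ∀ᵐ ω ∂P, ∀ t : ℝ≥0, ContinuousWithinAt (fun s => X s ω) (Ici t) t ∧
    ∃ l, Tendsto (fun s => X s ω) (𝓝[<] t) (𝓝 l)

/-- `Ψ` is the Lévy exponent of `X`: `E exp(i⟨ξ, X(t)⟩) = exp(-t Ψ(ξ))` for all `ξ` and all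
`t ≥ 0`. This determines `Ψ` uniquely. -/
def IsLevyExponent {d : ℕ} {Ω : Type*} [MeasurableSpace Ω]
    (Ψ : EuclideanSpace ℝ (Fin d) → ℂ)
    (X : ℝ≥0 → Ω → EuclideanSpace ℝ (Fin d)) (P : Measure Ω) : Prop :=
  ∀ (ξ : EuclideanSpace ℝ (Fin d)) (t : ℝ≥0),
    charFun (P.map (X t)) ξ = Complex.exp (-((t : ℝ) : ℂ) * Ψ ξ)

/-- `χ_ξ(x) = exp(-|x| Ψ(sign(x) ξ))` for real `x`. -/
def levyChi {d : ℕ} (Ψ : EuclideanSpace ℝ (Fin d) → ℂ) (ξ : EuclideanSpace ℝ (Fin d)) (x : ℝ) :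
    ℂ :=
  Complex.exp (-((|x| : ℝ) : ℂ) * Ψ (Real.sign x • ξ))

/-- `(Re χ_ξ(x))_+ = max {Re χ_ξ(x), 0}`. -/
def reChiPos {d : ℕ} (Ψ : EuclideanSpace ℝ (Fin d) → ℂ) (ξ : EuclideanSpace ℝ (Fin d)) (x : ℝ) :
    ℝ≥0∞ :=
  ENNReal.ofReal (max (levyChi Ψ ξ x).re 0)

/-- `(Re χ_ξ(x))_- = max {-Re χ_ξ(x), 0}`. -/
def reChiNeg {d : ℕ} (Ψ : EuclideanSpace ℝ (Fin d) → ℂ) (ξ : EuclideanSpace ℝ (Fin d)) (x : ℝ) :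
    ℝ≥0∞ :=
  ENNReal.ofReal (max (-(levyChi Ψ ξ x).re) 0)

/-- The gauge `g_{γ,+}(x) = ∫ (Re χ_ξ(x))_+ ‖ξ‖ ^ (-γ) dξ`, with values in `[0, ∞]`. -/
def gaugePos {d : ℕ} (Ψ : EuclideanSpace ℝ (Fin d) → ℂ) (γ : ℝ) (x : ℝ) : ℝ≥0∞ :=
  ∫⁻ ξ : EuclideanSpace ℝ (Fin d), reChiPos Ψ ξ x * ‖ξ‖ₑ ^ (-γ)

/-- The gauge `g_{γ,-}(x) = ∫ (Re χ_ξ(x))_- ‖ξ‖ ^ (-γ) dξ`, with values in `[0, ∞]`. -/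
def gaugeNeg {d : ℕ} (Ψ : EuclideanSpace ℝ (Fin d) → ℂ) (γ : ℝ) (x : ℝ) : ℝ≥0∞ :=
  ∫⁻ ξ : EuclideanSpace ℝ (Fin d), reChiNeg Ψ ξ x * ‖ξ‖ₑ ^ (-γ)

/-- The random image set `X(G) = {X(t) : t ∈ G}` for `G ⊆ [0, ∞)`. -/
def imageSet {d : ℕ} {Ω : Type*} (X : ℝ≥0 → Ω → EuclideanSpace ℝ (Fin d)) (G : Set ℝ) (ω : Ω) :
    Set (EuclideanSpace ℝ (Fin d)) :=
  {x | ∃ t : ℝ≥0, (t : ℝ) ∈ G ∧ X t ω = x}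

/-- The deterministic process `X(t) = t` in `ℝ^1`. -/
def driftProcess (Ω : Type*) (t : ℝ≥0) (_ : Ω) : EuclideanSpace ℝ (Fin 1) :=
  WithLp.toLp 2 (fun _ => (t : ℝ))

/-- The exponent `ξ ↦ -iξ` of the process `X(t) = t`. -/
def driftExponent (ξ : EuclideanSpace ℝ (Fin 1)) : ℂ :=
  -Complex.I * ((ξ 0 : ℝ) : ℂ)

end

/-! Let `μ` be a probability measure on times and let `ρ` be the law of `X(s) - X(t)`, where `s` and
`t` have law `μ` and `s`, `t`, `X` are independent. The characteristic function of `ρ` at `ξ` is the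
double integral of `χ_ξ(s - t)`, and its real part is `E |∫ exp(i⟨ξ, X(s)⟩) μ(ds)|²`, hence
nonnegative. Since the Riesz kernel is a Gamma mixture of Gaussians, Parseval's formula gives the
mean Riesz energy of the image of `μ` under `X` as `c ∫ Re ρ̂(ξ) ‖ξ‖^(β-d) dξ`, with `0 < c < ∞`
independent of `μ` (`exists_lintegral_enorm_rpow_eq`, `exists_mean_energy_eq`). Splitting `Re χ_ξ`
into its positive and negative parts (`fEnergy_reChiPos_eq`) shows that the `g_+`-energy of `μ` is
its `g_-`-energy plus `c⁻¹` times that mean energy. This gives (a) and (b) at once. It also gives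
(c): a finite mean energy is finite on almost every path, and there the image of `μ` is a measure of
finite energy on `X(G)`.

For (e) the mean energy of some deterministic `μ` on `G` has to be bounded, knowing only that with
positive probability `X(G)` carries some measure of finite energy, which may depend on the path in
an arbitrary way (`exists_mean_energy_ne_top`). The random measure is replaced by rational weights
on a time grid. There are countably many of these, so they can be selected measurably and averaged
over the path. The decisive inequality is `sum_sum_mean_le`: the mean energy of the averaged weights
is at most 16 times the mean energy of the random weights. It holds because each kernel value is
determined by the increments between two grid times, which are independent of the past, so that
Cauchy–Schwarz can be applied to the conditional expectations of the weights given the past. A weak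
limit as the grid is refined and the regularization removed yields `μ`. For the limit to live on `G`
and not merely on its closure, `G` is first replaced by the shrinking sets of Choquet's
capacitability argument (`exists_antitone_subsets_of_lt`).

For (d), the positive part of a cosine is not integrable against `y^(β-1)` at infinity, so `g_+` is
identically infinite, while the segment `[0, 1]` has positive Riesz capacity. -/

/-! ### Capacitability and universal measurability of analytic sets -/

/-- A sequence in the Baire space whose `n`-th term obeys the first `n` of a family of coordinate
bounds has a convergent subsequence. -/
lemma exists_tendsto_subseq_of_coordinate_bounds (k : ℕ → ℕ) (σ : ℕ → ℕ → ℕ)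
    (hσ : ∀ n, ∀ i < n, σ n i ≤ k i) :
    ∃ τ : ℕ → ℕ, ∃ φ : ℕ → ℕ, StrictMono φ ∧ Tendsto (σ ∘ φ) atTop (𝓝 τ) := by
  have hK : IsCompact (Set.pi univ fun i => Iic (k i)) :=
    isCompact_univ_pi fun i => (finite_Iic (k i)).isCompact
  obtain ⟨τ, -, φ, hφ, hlim⟩ := hK.tendsto_subseq (x := fun n i => min (σ n i) (k i))
    (fun n i _ => mem_Iic.2 (min_le_right (σ n i) (k i)))
  refine ⟨τ, φ, hφ, ?_⟩
  rw [tendsto_pi_nhds] at hlim ⊢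
  intro i
  refine (hlim i).congr' ?_
  filter_upwards [eventually_gt_atTop i] with n hn
  exact min_eq_left (hσ _ _ (hn.trans_le hφ.le_apply))

/-- **Capacitability.** A monotone set function that is continuous along increasing unions can be
bounded below along a decreasing sequence of subsets of the analytic set `range f` that shrinks to
a compact subset of `range f`. -/
theorem exists_antitone_subsets_of_lt {α : Type*} [TopologicalSpace α] {f : (ℕ → ℕ) → α}
    (hf : Continuous f) {Φ : Set α → ℝ≥0∞}
    (hup : ∀ S : ℕ → Set α, Monotone S → Φ (⋃ n, S n) = ⨆ n, Φ (S n)) {c : ℝ≥0∞}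
    (hc : c < Φ (range f)) :
    ∃ A : ℕ → Set α, Antitone A ∧ (∀ n, A n ⊆ range f) ∧ (∀ n, c < Φ (A n)) ∧
      ∀ y : ℕ → α, (∀ n, y n ∈ A n) →
        ∃ x ∈ range f, ∃ φ : ℕ → ℕ, StrictMono φ ∧ Tendsto (y ∘ φ) atTop (𝓝 x) := by
  have step (S : Set (ℕ → ℕ)) (n : ℕ) (h : c < Φ (f '' S)) :
      ∃ k, c < Φ (f '' (S ∩ {σ | σ n ≤ k})) := by
    have hU : f '' S = ⋃ k, f '' (S ∩ {σ | σ n ≤ k}) := by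
      rw [← image_iUnion, ← inter_iUnion]
      congr 1
      symm
      exact inter_eq_left.2 fun σ _ => mem_iUnion.2 ⟨σ n, le_refl (σ n)⟩
    have hmono : Monotone fun k => f '' (S ∩ {σ | σ n ≤ k}) := fun a b hab =>
      image_mono (inter_subset_inter_right _ fun σ (hσ : σ n ≤ a) => hσ.trans hab)
    rw [hU, hup _ hmono] at h
    exact lt_iSup_iff.1 h
  choose! K hK using step
  -- The coordinates are bounded one at a time, each bound keeping `Φ` above `c`. Only continuity
  -- along increasing unions is used; `Φ` is never evaluated on the compact intersection.
  let S : ℕ → Set (ℕ → ℕ) := fun n =>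
    Nat.rec univ (fun n S => S ∩ {σ | σ n ≤ K S n}) n
  have hS (n : ℕ) : S (n + 1) = S n ∩ {σ | σ n ≤ K (S n) n} := rfl
  have hlt (n : ℕ) : c < Φ (f '' S n) := by
    induction n with
    | zero => simpa [S] using hc
    | succ n ih => rw [hS]; exact hK _ _ ih
  have hanti : Antitone S := antitone_nat_of_succ_le fun n => by rw [hS]; exact inter_subset_left
  refine ⟨fun n => f '' S n, fun a b hab => image_mono (hanti hab),
    fun n => image_subset_range _ _, hlt, fun y hy => ?_⟩
  choose σ hσS hσy using hy
  obtain ⟨τ, φ, hφ, hlim⟩ := exists_tendsto_subseq_of_coordinate_bounds (fun i => K (S i) i) σ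
    fun n i hi => by
      have := hanti (Nat.succ_le_of_lt hi) (hσS n)
      exact ((hS i).subset this).2
  refine ⟨f τ, mem_range_self _, φ, hφ, ?_⟩
  have := (hf.tendsto τ).comp hlim
  refine this.congr fun n => ?_
  simp [hσy]

/-- A shrinking sequence as in `exists_antitone_subsets_of_lt` contains the limits of all points
that it approximates. -/
lemma mem_of_forall_dist_le {α : Type*} [PseudoMetricSpace α] [T2Space α] {B : Set α}
    {A : ℕ → Set α} (hA : ∀ y : ℕ → α, (∀ n, y n ∈ A n) →
      ∃ x ∈ B, ∃ φ : ℕ → ℕ, StrictMono φ ∧ Tendsto (y ∘ φ) atTop (𝓝 x))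
    {δ : ℕ → ℝ} (hδ : Tendsto δ atTop (𝓝 0)) {x : α}
    (hx : ∀ n, ∃ y ∈ A n, dist y x ≤ δ n) : x ∈ B := by
  choose y hyA hyx using hx
  obtain ⟨z, hz, φ, hφ, hlim⟩ := hA y hyA
  have h1 : Tendsto y atTop (𝓝 x) :=
    tendsto_iff_dist_tendsto_zero.2 (squeeze_zero (fun _ => dist_nonneg) hyx hδ)
  rwa [tendsto_nhds_unique (h1.comp hφ.tendsto_atTop) hlim]

/-- Analytic sets are universally measurable. -/
theorem MeasureTheory.AnalyticSet.nullMeasurableSet {α : Type*} [MetricSpace α]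
    [MeasurableSpace α] [BorelSpace α] {A : Set α} (hA : AnalyticSet A) (ν : Measure α)
    [IsFiniteMeasure ν] : NullMeasurableSet A ν := by
  rw [AnalyticSet] at hA
  rcases hA with rfl | ⟨f, hf, rfl⟩
  · exact nullMeasurableSet_empty
  have key (c : ℝ≥0∞) (hc : c < ν (range f)) :
      ∃ K ⊆ range f, MeasurableSet K ∧ c ≤ ν K := by
    obtain ⟨A, hanti, -, hcA, hlim⟩ := exists_antitone_subsets_of_lt hf (Φ := ν)
      (fun S hS => hS.measure_iUnion) hc
    -- A point of every closure is within `1 / (n + 1)` of `A n`, hence lies in `range f`; and a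
    -- finite measure is continuous along the decreasing closed sets.
    refine ⟨⋂ n, closure (A n), fun x hx => ?_, MeasurableSet.iInter fun n =>
      isClosed_closure.measurableSet, ?_⟩
    · refine mem_of_forall_dist_le hlim tendsto_one_div_add_atTop_nhds_zero_nat fun n => ?_
      obtain ⟨y, hy, hxy⟩ := Metric.mem_closure_iff.1 (mem_iInter.1 hx n) (1 / ((n : ℝ) + 1))
        (by positivity)
      exact ⟨y, hy, by rw [dist_comm]; exact hxy.le⟩
    · rw [Antitone.measure_iInter (fun a b hab => closure_mono (hanti hab))
        (fun n => isClosed_closure.measurableSet.nullMeasurableSet) ⟨0, measure_ne_top _ _⟩]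
      exact le_iInf fun n => (hcA n).le.trans (measure_mono subset_closure)
  rcases eq_or_ne (ν (range f)) 0 with h0 | h0
  · exact NullMeasurableSet.of_null h0
  obtain ⟨u, -, hu, hulim⟩ := exists_seq_strictMono_tendsto' (pos_iff_ne_zero.2 h0)
  choose K hKs hKm hKu using fun n => key (u n) (hu n).2
  refine NullMeasurableSet.congr (s := ⋃ n, K n)
    (MeasurableSet.iUnion hKm).nullMeasurableSet ?_
  refine ae_eq_of_subset_of_measure_ge (iUnion_subset hKs) ?_
    (MeasurableSet.iUnion hKm).nullMeasurableSet (measure_ne_top _ _)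
  exact le_of_tendsto' hulim fun n => (hKu n).trans (measure_mono (subset_iUnion K n))

/-- The image of a Borel set of full measure carries the image measure. -/
lemma measure_map_compl_image_eq_zero {α β : Type*} [TopologicalSpace α] [PolishSpace α]
    [MeasurableSpace α] [BorelSpace α] [MetricSpace β] [SecondCountableTopology β]
    [MeasurableSpace β] [BorelSpace β] {μ : Measure α} [IsFiniteMeasure μ] {f : α → β}
    (hf : Measurable f) {s : Set α} (hs : MeasurableSet s) (hμ : μ sᶜ = 0) :
    μ.map f (f '' s)ᶜ = 0 := by
  have h := (hs.analyticSet_image hf).nullMeasurableSet (μ.map f)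
  rw [Measure.map_apply₀ hf.aemeasurable h.compl]
  exact measure_mono_null (fun x hx hxs => hx (mem_image_of_mem f hxs)) hμ

/-! ### Energy of averaged random weights -/

/-- A double sum of a symmetric nonnegative array is at most twice its upper triangular part. -/
lemma sum_sum_le_two_mul_upper {n : ℕ} {M : ℕ → ℕ → ℝ} (hsymm : ∀ i j, M i j = M j i)
    (hM : ∀ i j, 0 ≤ M i j) :
    ∑ i ∈ Finset.range n, ∑ j ∈ Finset.range n, M i j ≤
      2 * ∑ i ∈ Finset.range n, ∑ j ∈ Finset.range n, if i ≤ j then M i j else 0 := by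
  have h : ∑ i ∈ Finset.range n, ∑ j ∈ Finset.range n, M i j ≤
      ∑ i ∈ Finset.range n, ∑ j ∈ Finset.range n,
        ((if i ≤ j then M i j else 0) + if j ≤ i then M j i else 0) := by
    refine Finset.sum_le_sum fun i _ => Finset.sum_le_sum fun j _ => ?_
    have h1 := hM i j
    have h2 := hsymm i j
    rcases le_total i j with h | h <;> simp only [h, if_true] <;> split_ifs <;> linarith
  simp only [Finset.sum_add_distrib] at h
  rw [Finset.sum_comm (f := fun i j => if j ≤ i then M j i else 0)] at h
  linarith

/-- The arithmetic-geometric form of the Cauchy–Schwarz inequality for a positive semidefinite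
array. -/
lemma four_mul_sum_sum_le {n : ℕ} {K : ℕ → ℕ → ℝ} (hsymm : ∀ i j, K i j = K j i)
    (hpos : ∀ c : ℕ → ℝ, 0 ≤ ∑ i ∈ Finset.range n, ∑ j ∈ Finset.range n, c i * c j * K i j)
    (a b : ℕ → ℝ) :
    4 * ∑ i ∈ Finset.range n, ∑ j ∈ Finset.range n, b i * a j * K i j ≤
      ∑ i ∈ Finset.range n, ∑ j ∈ Finset.range n, b i * b j * K i j +
      4 * ∑ i ∈ Finset.range n, ∑ j ∈ Finset.range n, a i * a j * K i j := by
  have h := hpos fun i => b i - 2 * a i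
  have hswap : ∑ i ∈ Finset.range n, ∑ j ∈ Finset.range n, a i * b j * K i j =
      ∑ i ∈ Finset.range n, ∑ j ∈ Finset.range n, b i * a j * K i j := by
    rw [Finset.sum_comm]
    refine Finset.sum_congr rfl fun i _ => Finset.sum_congr rfl fun j _ => ?_
    rw [hsymm j i]; ring
  have hexp : ∑ i ∈ Finset.range n, ∑ j ∈ Finset.range n,
      (b i - 2 * a i) * (b j - 2 * a j) * K i j =
      ∑ i ∈ Finset.range n, ∑ j ∈ Finset.range n, b i * b j * K i j -
      2 * ∑ i ∈ Finset.range n, ∑ j ∈ Finset.range n, b i * a j * K i j -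
      2 * ∑ i ∈ Finset.range n, ∑ j ∈ Finset.range n, a i * b j * K i j +
      4 * ∑ i ∈ Finset.range n, ∑ j ∈ Finset.range n, a i * a j * K i j := by
    simp only [Finset.mul_sum, ← Finset.sum_sub_distrib, ← Finset.sum_add_distrib]
    refine Finset.sum_congr rfl fun i _ => Finset.sum_congr rfl fun j _ => ?_
    ring
  rw [hexp, hswap] at h
  linarith

section Domination

variable {Ω : Type*} {m0 : MeasurableSpace Ω} {P : Measure Ω} [IsProbabilityMeasure P]
  {F : Filtration ℕ m0} {K : ℕ → ℕ → Ω → ℝ} {C : ℝ}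

/-- For an adapted kernel with future values independent of the past, the energy of the mean of a
random weight is controlled by the mean of its energy. -/
theorem sum_sum_mean_le (hsymm : ∀ i j ω, K i j ω = K j i ω)
    (hnonneg : ∀ i j ω, 0 ≤ K i j ω) (hbound : ∀ i j ω, K i j ω ≤ C)
    (hpos : ∀ n ω (c : ℕ → ℝ),
      0 ≤ ∑ i ∈ Finset.range n, ∑ j ∈ Finset.range n, c i * c j * K i j ω)
    (hmeas : ∀ i j, i ≤ j → StronglyMeasurable[F j] (K i j))
    (hindep : ∀ i j, i ≤ j → Indep (F i) (MeasurableSpace.comap (K i j) inferInstance) P)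
    {a : ℕ → Ω → ℝ} (ha : ∀ i, Measurable (a i)) (ha0 : ∀ i ω, 0 ≤ a i ω)
    (ha1 : ∀ i ω, a i ω ≤ 1) (n : ℕ) :
    ∑ i ∈ Finset.range n, ∑ j ∈ Finset.range n, P[a i] * P[a j] * P[K i j] ≤
      16 * ∑ i ∈ Finset.range n, ∑ j ∈ Finset.range n, P[fun ω => a i ω * a j ω * K i j ω] := by
  have hai (i : ℕ) : Integrable (a i) P :=
    Integrable.of_bound (ha i).aestronglyMeasurable 1 (.of_forall fun ω => by
      rw [Real.norm_eq_abs, abs_of_nonneg (ha0 i ω)]; exact ha1 i ω)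
  have hKm (i j : ℕ) : StronglyMeasurable (K i j) := by
    rcases le_total i j with h | h
    · exact (hmeas i j h).mono (F.le j)
    · rw [show K i j = K j i from funext (hsymm i j)]
      exact (hmeas j i h).mono (F.le i)
  have hKn (i j : ℕ) (ω : Ω) : ‖K i j ω‖ ≤ C := by
    rw [Real.norm_eq_abs, abs_of_nonneg (hnonneg i j ω)]; exact hbound i j ω
  have hKi (i j : ℕ) : Integrable (K i j) P :=
    Integrable.of_bound (hKm i j).aestronglyMeasurable C (.of_forall (hKn i j))
  -- a version of the conditional expectations with values in `[0, 1]`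
  let b : ℕ → Ω → ℝ := fun i ω => max 0 (min 1 ((P[a i | F i]) ω))
  have hbae (i : ℕ) : b i =ᵐ[P] P[a i | F i] := by
    have h0 : 0 ≤ᵐ[P] P[a i | F i] := condExp_nonneg (.of_forall (ha0 i))
    have h1 : P[a i | F i] ≤ᵐ[P] P[fun _ => (1 : ℝ) | F i] :=
      condExp_mono (hai i) (integrable_const 1) (.of_forall (ha1 i))
    rw [condExp_const (F.le i)] at h1
    filter_upwards [h0, h1] with ω h0 h1
    simp only [b]
    rw [min_eq_right h1]; exact max_eq_right h0
  have hbm (i : ℕ) : StronglyMeasurable[F i] (b i) :=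
    (by fun_prop : Continuous fun x : ℝ => max 0 (min 1 x)).comp_stronglyMeasurable
      stronglyMeasurable_condExp
  have hb0 (i : ℕ) (ω : Ω) : 0 ≤ b i ω := le_max_left _ _
  have hb1 (i : ℕ) (ω : Ω) : b i ω ≤ 1 := max_le zero_le_one (min_le_left _ _)
  have hbi (i : ℕ) : Integrable (b i) P :=
    Integrable.of_bound ((hbm i).mono (F.le i)).aestronglyMeasurable 1 (.of_forall fun ω => by
      rw [Real.norm_eq_abs, abs_of_nonneg (hb0 i ω)]; exact hb1 i ω)
  have hint {u v : Ω → ℝ} (hu : AEStronglyMeasurable u P) (hv : AEStronglyMeasurable v P)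
      (hu0 : ∀ ω, 0 ≤ u ω) (hu1 : ∀ ω, u ω ≤ 1) (hv0 : ∀ ω, 0 ≤ v ω) (hv1 : ∀ ω, v ω ≤ 1)
      (i j : ℕ) : Integrable (fun ω => u ω * v ω * K i j ω) P := by
    refine (hKi i j).bdd_mul (c := 1) (hu.mul hv) (.of_forall fun ω => ?_)
    rw [Real.norm_eq_abs, abs_of_nonneg (mul_nonneg (hu0 ω) (hv0 ω))]
    exact mul_le_one₀ (hu1 ω) (hv0 ω) (hv1 ω)
  have ham (i : ℕ) : AEStronglyMeasurable (a i) P := (ha i).aestronglyMeasurable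
  have hbm' (i : ℕ) : AEStronglyMeasurable (b i) P := (hbi i).aestronglyMeasurable
  -- replacing the later of two weights by its conditional expectation
  have hproj (i j : ℕ) (hij : i ≤ j) :
      P[fun ω => b i ω * b j ω * K i j ω] = P[fun ω => b i ω * a j ω * K i j ω] := by
    have hg : StronglyMeasurable[F j] (fun ω => b i ω * K i j ω) :=
      ((hbm i).mono (F.mono hij)).mul (hmeas i j hij)
    have h2 : P[(fun ω => b i ω * K i j ω) * a j | F j] =ᵐ[P]
        (fun ω => b i ω * K i j ω) * P[a j | F j] := by
      refine condExp_mul_of_stronglyMeasurable_left hg ?_ (hai j)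
      refine (hint (hbm' i) (ham j) (hb0 i) (hb1 i) (ha0 j) (ha1 j) i j).congr
        (.of_forall fun ω => ?_)
      simp only [Pi.mul_apply]; ring
    calc P[fun ω => b i ω * b j ω * K i j ω]
        = P[P[(fun ω => b i ω * K i j ω) * a j | F j]] := by
          refine integral_congr_ae ?_
          filter_upwards [h2, hbae j] with ω h2 h3
          rw [h2, Pi.mul_apply, ← h3]; ring
      _ = _ := by
          rw [integral_condExp (F.le j)]
          refine integral_congr_ae (.of_forall fun ω => ?_)
          simp only [Pi.mul_apply]; ring
  have hmean (i : ℕ) : P[b i] = P[a i] := by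
    rw [integral_congr_ae (hbae i), integral_condExp (F.le i)]
  -- The only use of independence: `b i` is determined by the past at `i`, while `K i j` is
  -- independent of that past.
  have hfact (i j : ℕ) (hij : i ≤ j) : P[fun ω => b i ω * K i j ω] = P[a i] * P[K i j] := by
    have hI : IndepFun (b i) (K i j) P := by
      rw [IndepFun_iff_Indep]
      exact indep_of_indep_of_le_left (hindep i j hij) (hbm i).measurable.comap_le
    rw [hI.integral_fun_mul_eq_mul_integral (hbm' i) (hKi i j).aestronglyMeasurable, hmean]
  have hma0 (i : ℕ) : 0 ≤ P[a i] := integral_nonneg (ha0 i)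
  have hma1 (i : ℕ) : P[a i] ≤ 1 := by
    have h := integral_mono (hai i) (integrable_const 1) (ha1 i)
    simpa using h
  -- the two Cauchy–Schwarz steps
  have hCS (u v : ℕ → Ω → ℝ) (hu : ∀ i, AEStronglyMeasurable (u i) P)
      (hv : ∀ i, AEStronglyMeasurable (v i) P) (hu0 : ∀ i ω, 0 ≤ u i ω) (hu1 : ∀ i ω, u i ω ≤ 1)
      (hv0 : ∀ i ω, 0 ≤ v i ω) (hv1 : ∀ i ω, v i ω ≤ 1) :
      4 * ∑ i ∈ Finset.range n, ∑ j ∈ Finset.range n, P[fun ω => u i ω * v j ω * K i j ω] ≤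
        ∑ i ∈ Finset.range n, ∑ j ∈ Finset.range n, P[fun ω => u i ω * u j ω * K i j ω] +
        4 * ∑ i ∈ Finset.range n, ∑ j ∈ Finset.range n, P[fun ω => v i ω * v j ω * K i j ω] := by
    have hsum (u v : ℕ → Ω → ℝ) (hu : ∀ i, AEStronglyMeasurable (u i) P)
        (hv : ∀ i, AEStronglyMeasurable (v i) P) (hu0 : ∀ i ω, 0 ≤ u i ω)
        (hu1 : ∀ i ω, u i ω ≤ 1) (hv0 : ∀ i ω, 0 ≤ v i ω) (hv1 : ∀ i ω, v i ω ≤ 1) :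
        Integrable (fun ω => ∑ i ∈ Finset.range n, ∑ j ∈ Finset.range n,
          u i ω * v j ω * K i j ω) P ∧
        P[fun ω => ∑ i ∈ Finset.range n, ∑ j ∈ Finset.range n, u i ω * v j ω * K i j ω] =
          ∑ i ∈ Finset.range n, ∑ j ∈ Finset.range n, P[fun ω => u i ω * v j ω * K i j ω] := by
      have h (i j : ℕ) := hint (hu i) (hv j) (hu0 i) (hu1 i) (hv0 j) (hv1 j) i j
      refine ⟨integrable_finsetSum _ fun i _ => integrable_finsetSum _ fun j _ => h i j, ?_⟩
      rw [integral_finsetSum _ fun i _ => integrable_finsetSum _ fun j _ => h i j]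
      exact Finset.sum_congr rfl fun i _ => integral_finsetSum _ fun j _ => h i j
    obtain ⟨i1, e1⟩ := hsum u v hu hv hu0 hu1 hv0 hv1
    obtain ⟨i2, e2⟩ := hsum u u hu hu hu0 hu1 hu0 hu1
    obtain ⟨i3, e3⟩ := hsum v v hv hv hv0 hv1 hv0 hv1
    rw [← e1, ← e2, ← e3, ← integral_const_mul, ← integral_const_mul,
      ← integral_add i2 (i3.const_mul 4)]
    exact integral_mono (i1.const_mul 4) (i2.add (i3.const_mul 4)) fun ω =>
      four_mul_sum_sum_le (fun i j => hsymm i j ω) (hpos n ω) (fun i => v i ω) fun i => u i ω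
  have hB : ∑ i ∈ Finset.range n, ∑ j ∈ Finset.range n, P[fun ω => b i ω * b j ω * K i j ω] ≤
      2 * ∑ i ∈ Finset.range n, ∑ j ∈ Finset.range n, P[fun ω => b i ω * a j ω * K i j ω] := by
    refine (sum_sum_le_two_mul_upper (fun i j => ?_) fun i j => integral_nonneg fun ω =>
      mul_nonneg (mul_nonneg (hb0 i ω) (hb0 j ω)) (hnonneg i j ω)).trans ?_
    · refine integral_congr_ae (.of_forall fun ω => ?_)
      simp only [hsymm i j ω]; ring
    · refine mul_le_mul_of_nonneg_left (Finset.sum_le_sum fun i _ => Finset.sum_le_sum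
        fun j _ => ?_) zero_le_two
      split_ifs with hij
      · exact (hproj i j hij).le
      · exact integral_nonneg fun ω => mul_nonneg (mul_nonneg (hb0 i ω) (ha0 j ω)) (hnonneg i j ω)
  have hS : ∑ i ∈ Finset.range n, ∑ j ∈ Finset.range n, P[a i] * P[a j] * P[K i j] ≤
      2 * ∑ i ∈ Finset.range n, ∑ j ∈ Finset.range n, P[fun ω => b i ω * P[a j] * K i j ω] := by
    refine (sum_sum_le_two_mul_upper (fun i j => ?_) fun i j => mul_nonneg (mul_nonneg
      (hma0 i) (hma0 j)) (integral_nonneg (hnonneg i j))).trans ?_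
    · rw [show K i j = K j i from funext (hsymm i j)]; ring
    · refine mul_le_mul_of_nonneg_left (Finset.sum_le_sum fun i _ => Finset.sum_le_sum
        fun j _ => ?_) zero_le_two
      split_ifs with hij
      · have : P[fun ω => b i ω * P[a j] * K i j ω] = P[a j] * P[fun ω => b i ω * K i j ω] := by
          rw [← integral_const_mul]
          exact integral_congr_ae (.of_forall fun ω => by simp only; ring)
        rw [this, hfact i j hij]
        exact le_of_eq (by ring)
      · exact integral_nonneg fun ω => mul_nonneg (mul_nonneg (hb0 i ω) (hma0 j)) (hnonneg i j ω)
  have hconst (i j : ℕ) : P[fun ω => P[a i] * P[a j] * K i j ω] = P[a i] * P[a j] * P[K i j] :=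
    integral_const_mul _ _
  have h1 := hCS b a hbm' ham hb0 hb1 ha0 ha1
  have h2 := hCS (fun i _ => P[a i]) b (fun i => aestronglyMeasurable_const) hbm'
    (fun i _ => hma0 i) (fun i _ => hma1 i) hb0 hb1
  have h3 : ∑ i ∈ Finset.range n, ∑ j ∈ Finset.range n, P[fun ω => P[a i] * b j ω * K i j ω] =
      ∑ i ∈ Finset.range n, ∑ j ∈ Finset.range n, P[fun ω => b i ω * P[a j] * K i j ω] := by
    rw [Finset.sum_comm]
    refine Finset.sum_congr rfl fun i _ => Finset.sum_congr rfl fun j _ => ?_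
    refine integral_congr_ae (.of_forall fun ω => ?_)
    simp only [hsymm i j ω]; ring
  simp only [hconst, h3] at h2
  -- Let `S`, `B`, `A` be the double sums for the means, for `b` and for `a`. Then `hB` and `h1`
  -- give `B ≤ B / 2 + 2 A`, so `B ≤ 4 A`; in the same way `hS` and `h2` give `S ≤ S / 2 + 2 B`, so
  -- `S ≤ 4 B`. This is the constant 16.
  linarith

end Domination

/-! ### Gaussian Fourier transforms and the regularized Riesz kernel -/

section GaussianFourier

variable {V : Type*} [NormedAddCommGroup V] [InnerProductSpace ℝ V] [FiniteDimensional ℝ V]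
  [MeasurableSpace V] [BorelSpace V]

lemma integrable_exp_neg_norm_sq_div {t : ℝ} (ht : 0 < t) :
    Integrable fun ξ : V => Real.exp (-(‖ξ‖ ^ 2 / (4 * t))) := by
  have h := GaussianFourier.integrable_cexp_neg_mul_sq_norm_add (V := V)
    (b := ((1 / (4 * t) : ℝ) : ℂ)) (by rw [Complex.ofReal_re]; positivity) 0 0
  refine h.re.congr (.of_forall fun ξ => ?_)
  have : (-((1 / (4 * t) : ℝ) : ℂ) * (‖ξ‖ : ℂ) ^ 2 + 0 * ((inner ℝ (0 : V) ξ : ℝ) : ℂ)) =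
      ((-(‖ξ‖ ^ 2 / (4 * t)) : ℝ) : ℂ) := by
    push_cast; ring
  simp only [this, ← Complex.ofReal_exp]
  rfl

/-- The Gaussian is the Fourier transform of a Gaussian. -/
lemma integral_cos_inner_mul_exp_neg {t : ℝ} (ht : 0 < t) (x : V) :
    ∫ ξ : V, Real.cos (inner ℝ x ξ) * Real.exp (-(‖ξ‖ ^ 2 / (4 * t))) =
      (4 * Real.pi * t) ^ (Module.finrank ℝ V / 2 : ℝ) * Real.exp (-(t * ‖x‖ ^ 2)) := by
  have hb : 0 < (((1 / (4 * t) : ℝ) : ℂ)).re := by rw [Complex.ofReal_re]; positivity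
  have h := GaussianFourier.integral_cexp_neg_mul_sq_norm_add hb Complex.I x
  have hi := GaussianFourier.integrable_cexp_neg_mul_sq_norm_add hb Complex.I x
  have h' := congrArg Complex.re h
  rw [← RCLike.re_eq_complex_re, ← integral_re hi] at h'
  convert h' using 1
  · refine integral_congr_ae (.of_forall fun ξ => ?_)
    have : (-((1 / (4 * t) : ℝ) : ℂ) * (‖ξ‖ : ℂ) ^ 2 + Complex.I * ((inner ℝ x ξ : ℝ) : ℂ)) =
        ((-(‖ξ‖ ^ 2 / (4 * t)) : ℝ) : ℂ) + ((inner ℝ x ξ : ℝ) : ℂ) * Complex.I := by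
      push_cast; ring
    simp only [RCLike.re_eq_complex_re]
    rw [this, Complex.exp_add, ← Complex.ofReal_exp, Complex.re_ofReal_mul,
      Complex.exp_ofReal_mul_I_re]
    ring
  · have e1 : ((Real.pi : ℂ) / ((1 / (4 * t) : ℝ) : ℂ)) = ((4 * Real.pi * t : ℝ) : ℂ) := by
      push_cast; field_simp
    have e2 : (Complex.I ^ 2 * (‖x‖ : ℂ) ^ 2 / (4 * ((1 / (4 * t) : ℝ) : ℂ))) =
        ((-(t * ‖x‖ ^ 2) : ℝ) : ℂ) := by
      have : (t : ℂ) ≠ 0 := by exact_mod_cast ht.ne'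
      rw [Complex.I_sq]; push_cast; field_simp
    have e3 : ((Module.finrank ℝ V : ℂ) / 2) = ((Module.finrank ℝ V / 2 : ℝ) : ℂ) := by
      push_cast; ring
    rw [e1, e2, e3, ← Complex.ofReal_cpow (by positivity), ← Complex.ofReal_exp,
      ← Complex.ofReal_mul]
    rfl

lemma re_charFun_eq_integral_cos (ρ : Measure V) [IsFiniteMeasure ρ] (ξ : V) :
    (charFun ρ ξ).re = ∫ x, Real.cos (inner ℝ x ξ) ∂ρ := by
  have hi : Integrable (fun x => Complex.exp ((inner ℝ x ξ : ℝ) * Complex.I)) ρ :=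
    Integrable.of_bound (by fun_prop) 1 (.of_forall fun x => by
      rw [Complex.norm_exp_ofReal_mul_I])
  rw [charFun_apply, ← RCLike.re_eq_complex_re, ← integral_re hi]
  refine integral_congr_ae (.of_forall fun x => ?_)
  simp only [RCLike.re_eq_complex_re]
  rw [Complex.exp_ofReal_mul_I_re]

/-- Parseval's formula for a Gaussian against a finite measure. -/
lemma integral_re_charFun_mul_exp_neg {t : ℝ} (ht : 0 < t) (ρ : Measure V) [IsFiniteMeasure ρ] :
    ∫ ξ : V, (charFun ρ ξ).re * Real.exp (-(‖ξ‖ ^ 2 / (4 * t))) =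
      (4 * Real.pi * t) ^ (Module.finrank ℝ V / 2 : ℝ) *
        ∫ x, Real.exp (-(t * ‖x‖ ^ 2)) ∂ρ := by
  simp_rw [← integral_const_mul, ← integral_cos_inner_mul_exp_neg ht,
    re_charFun_eq_integral_cos, ← integral_mul_const]
  refine integral_integral_swap ?_
  have h : Integrable (fun p : V × V => Real.exp (-(‖p.1‖ ^ 2 / (4 * t)))) (volume.prod ρ) := by
    have := (integrable_exp_neg_norm_sq_div (V := V) ht).mul_prod (integrable_const (μ := ρ) (1 : ℝ))
    simpa using this
  refine h.bdd_mul (c := 1) (Continuous.aestronglyMeasurable (by fun_prop))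
    (.of_forall fun p => ?_)
  exact Real.abs_cos_le_one _

/-- The Gaussian kernel is positive semidefinite. -/
lemma sum_sum_exp_neg_nonneg {t : ℝ} (ht : 0 < t) (n : ℕ) (c : ℕ → ℝ) (x : ℕ → V) :
    0 ≤ ∑ i ∈ Finset.range n, ∑ j ∈ Finset.range n,
      c i * c j * Real.exp (-(t * ‖x i - x j‖ ^ 2)) := by
  have hpos : 0 < (4 * Real.pi * t) ^ (Module.finrank ℝ V / 2 : ℝ) := by positivity
  refine nonneg_of_mul_nonneg_right ?_ hpos
  have hint (i j : ℕ) : Integrable fun ξ : V => c i * c j *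
      (Real.cos (inner ℝ (x i - x j) ξ) * Real.exp (-(‖ξ‖ ^ 2 / (4 * t)))) := by
    refine Integrable.const_mul ?_ _
    refine (integrable_exp_neg_norm_sq_div ht).bdd_mul (c := 1)
      (Continuous.aestronglyMeasurable (by fun_prop)) (.of_forall fun ξ => ?_)
    exact Real.abs_cos_le_one _
  have h : (4 * Real.pi * t) ^ (Module.finrank ℝ V / 2 : ℝ) *
      ∑ i ∈ Finset.range n, ∑ j ∈ Finset.range n,
        c i * c j * Real.exp (-(t * ‖x i - x j‖ ^ 2)) =
      ∫ ξ : V, ∑ i ∈ Finset.range n, ∑ j ∈ Finset.range n, c i * c j *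
        (Real.cos (inner ℝ (x i - x j) ξ) * Real.exp (-(‖ξ‖ ^ 2 / (4 * t)))) := by
    rw [integral_finsetSum _ fun i _ => integrable_finsetSum _ fun j _ => hint i j, Finset.mul_sum]
    refine Finset.sum_congr rfl fun i _ => ?_
    rw [integral_finsetSum _ fun j _ => hint i j, Finset.mul_sum]
    refine Finset.sum_congr rfl fun j _ => ?_
    rw [integral_const_mul, integral_cos_inner_mul_exp_neg ht]
    ring
  rw [h]
  refine integral_nonneg fun ξ => ?_
  -- The quadratic form of `cos ⟨x i - x j, ξ⟩` is `|∑ c i exp(i⟨x i, ξ⟩)|²`, written out in real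
  -- and imaginary parts.
  have e : ∑ i ∈ Finset.range n, ∑ j ∈ Finset.range n, c i * c j *
        (Real.cos (inner ℝ (x i - x j) ξ) * Real.exp (-(‖ξ‖ ^ 2 / (4 * t)))) =
      ((∑ i ∈ Finset.range n, c i * Real.cos (inner ℝ (x i) ξ)) ^ 2 +
        (∑ i ∈ Finset.range n, c i * Real.sin (inner ℝ (x i) ξ)) ^ 2) *
          Real.exp (-(‖ξ‖ ^ 2 / (4 * t))) := by
    rw [sq (∑ i ∈ _, _), sq (∑ i ∈ _, _), Finset.sum_mul_sum, Finset.sum_mul_sum, ← Finset.sum_add_distrib, Finset.sum_mul]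
    refine Finset.sum_congr rfl fun i _ => ?_
    rw [← Finset.sum_add_distrib, Finset.sum_mul]
    refine Finset.sum_congr rfl fun j _ => ?_
    rw [inner_sub_left, Real.cos_sub]
    ring
  simp only [Pi.zero_apply]
  rw [e]
  positivity

/-- The regularized Riesz kernel `(‖x‖² + ε) ^ (-β / 2)`. -/
noncomputable def regRiesz (β ε : ℝ) (x : V) : ℝ := (‖x‖ ^ 2 + ε) ^ (-(β / 2))

omit [InnerProductSpace ℝ V] [FiniteDimensional ℝ V] [MeasurableSpace V] [BorelSpace V]

lemma regRiesz_nonneg (β : ℝ) {ε : ℝ} (hε : 0 < ε) (x : V) : 0 ≤ regRiesz β ε x := by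
  unfold regRiesz; positivity

lemma regRiesz_neg (β ε : ℝ) (x : V) : regRiesz β ε (-x) = regRiesz β ε x := by
  simp [regRiesz]

lemma regRiesz_anti {β : ℝ} (hβ : 0 < β) {ε δ : ℝ} (hε : 0 < ε) (h : ε ≤ δ) (x : V) :
    regRiesz β δ x ≤ regRiesz β ε x :=
  Real.rpow_le_rpow_of_nonpos (by positivity) (by linarith) (by linarith)

lemma regRiesz_le {β : ℝ} (hβ : 0 < β) {ε : ℝ} (hε : 0 < ε) (x : V) :
    regRiesz β ε x ≤ ε ^ (-(β / 2)) :=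
  Real.rpow_le_rpow_of_nonpos hε (by nlinarith [sq_nonneg ‖x‖]) (by linarith)

lemma continuous_regRiesz (β : ℝ) {ε : ℝ} (hε : 0 < ε) :
    Continuous (regRiesz β ε : V → ℝ) := by
  unfold regRiesz
  refine Continuous.rpow_const (by fun_prop) fun x => Or.inl ?_
  positivity

lemma ofReal_regRiesz_le {β : ℝ} (hβ : 0 < β) {ε : ℝ} (hε : 0 < ε) (x : V) :
    ENNReal.ofReal (regRiesz β ε x) ≤ ‖x‖ₑ ^ (-β) := by
  rcases eq_or_ne x 0 with rfl | hx
  · simp [ENNReal.zero_rpow_of_neg (neg_lt_zero.2 hβ)]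
  · have hn : 0 < ‖x‖ := norm_pos_iff.2 hx
    rw [← ofReal_norm, ENNReal.ofReal_rpow_of_pos hn]
    refine ENNReal.ofReal_le_ofReal ?_
    have : ‖x‖ ^ (-β) = (‖x‖ ^ 2) ^ (-(β / 2)) := by
      rw [← Real.rpow_natCast, ← Real.rpow_mul hn.le]; congr 1; push_cast; ring
    rw [this]
    exact Real.rpow_le_rpow_of_nonpos (by positivity) (by linarith) (by linarith)

/-- The limit is taken in `[0, ∞]`, where powers are continuous even at 0, so the singularity `x =
0` needs no separate treatment. -/
lemma tendsto_ofReal_regRiesz (β : ℝ) (x : V) :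
    Tendsto (fun n : ℕ => ENNReal.ofReal (regRiesz β (1 / ((n : ℝ) + 1)) x)) atTop
      (𝓝 (‖x‖ₑ ^ (-β))) := by
  have h0 : Tendsto (fun n : ℕ => ‖x‖ ^ 2 + 1 / ((n : ℝ) + 1)) atTop (𝓝 (‖x‖ ^ 2)) := by
    simpa using tendsto_one_div_add_atTop_nhds_zero_nat.const_add (‖x‖ ^ 2)
  have h1 := ((ENNReal.continuous_rpow_const (y := -(β / 2))).tendsto _).comp
    (ENNReal.tendsto_ofReal h0)
  have e : ENNReal.ofReal (‖x‖ ^ 2) ^ (-(β / 2)) = ‖x‖ₑ ^ (-β) := by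
    rw [ENNReal.ofReal_pow (norm_nonneg _), ofReal_norm, ← ENNReal.rpow_natCast,
      ← ENNReal.rpow_mul]
    congr 1; push_cast; ring
  rw [← e]
  refine h1.congr fun n => ?_
  simp only [Function.comp, regRiesz]
  rw [ENNReal.ofReal_rpow_of_pos (by positivity)]

end GaussianFourier

/-! ### Riesz kernels as Gaussian mixtures and Parseval's formula -/

section Riesz

variable {V : Type*} [NormedAddCommGroup V] [InnerProductSpace ℝ V] [FiniteDimensional ℝ V]
  [MeasurableSpace V] [BorelSpace V]

/-- The regularized Riesz kernel is positive semidefinite. -/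
lemma sum_sum_regRiesz_nonneg {β ε : ℝ} (hβ : 0 < β) (hε : 0 < ε) (n : ℕ) (c : ℕ → ℝ)
    (x : ℕ → V) :
    0 ≤ ∑ i ∈ Finset.range n, ∑ j ∈ Finset.range n, c i * c j * regRiesz β ε (x i - x j) := by
  have hΓ : 0 < Real.Gamma (β / 2) := Real.Gamma_pos_of_pos (by positivity)
  refine nonneg_of_mul_nonneg_right ?_ hΓ
  have hmix (y : V) : Real.Gamma (β / 2) * regRiesz β ε y =
      ∫ t in Ioi (0 : ℝ), t ^ (β / 2 - 1) * Real.exp (-((‖y‖ ^ 2 + ε) * t)) := by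
    rw [Real.integral_rpow_mul_exp_neg_mul_Ioi (by positivity) (by positivity), regRiesz,
      one_div, Real.inv_rpow (by positivity), Real.rpow_neg (by positivity), mul_comm]
  have hint (y : V) : IntegrableOn (fun t : ℝ =>
      t ^ (β / 2 - 1) * Real.exp (-((‖y‖ ^ 2 + ε) * t))) (Ioi 0) := by
    -- The integral of a nonintegrable function is 0 by convention, whereas this one has a positive
    -- value.
    by_contra h
    have h1 := hmix y
    rw [integral_undef h] at h1
    have : 0 < regRiesz β ε y := by unfold regRiesz; positivity
    exact (mul_pos hΓ this).ne' h1
  have h : Real.Gamma (β / 2) * ∑ i ∈ Finset.range n, ∑ j ∈ Finset.range n,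
        c i * c j * regRiesz β ε (x i - x j) =
      ∫ t in Ioi (0 : ℝ), ∑ i ∈ Finset.range n, ∑ j ∈ Finset.range n,
        c i * c j * (t ^ (β / 2 - 1) * Real.exp (-((‖x i - x j‖ ^ 2 + ε) * t))) := by
    rw [integral_finsetSum _ fun i _ => integrable_finsetSum _ fun j _ => (hint _).const_mul _,
      Finset.mul_sum]
    refine Finset.sum_congr rfl fun i _ => ?_
    rw [integral_finsetSum _ fun j _ => (hint _).const_mul _, Finset.mul_sum]
    refine Finset.sum_congr rfl fun j _ => ?_
    rw [integral_const_mul, ← hmix]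
    ring
  rw [h]
  refine setIntegral_nonneg measurableSet_Ioi fun t (ht : 0 < t) => ?_
  have e : ∑ i ∈ Finset.range n, ∑ j ∈ Finset.range n,
        c i * c j * (t ^ (β / 2 - 1) * Real.exp (-((‖x i - x j‖ ^ 2 + ε) * t))) =
      (t ^ (β / 2 - 1) * Real.exp (-(ε * t))) * ∑ i ∈ Finset.range n, ∑ j ∈ Finset.range n,
        c i * c j * Real.exp (-(t * ‖x i - x j‖ ^ 2)) := by
    simp only [Finset.mul_sum]
    refine Finset.sum_congr rfl fun i _ => Finset.sum_congr rfl fun j _ => ?_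
    rw [show -((‖x i - x j‖ ^ 2 + ε) * t) = -(ε * t) + -(t * ‖x i - x j‖ ^ 2) by ring,
      Real.exp_add]
    ring
  rw [e]
  exact mul_nonneg (by positivity) (sum_sum_exp_neg_nonneg ht n c x)

omit [InnerProductSpace ℝ V] [FiniteDimensional ℝ V] [MeasurableSpace V] [BorelSpace V] in
/-- The Riesz kernel as a mixture of Gaussians. -/
lemma ofReal_Gamma_mul_enorm_rpow {β : ℝ} (hβ : 0 < β) (x : V) :
    ENNReal.ofReal (Real.Gamma (β / 2)) * ‖x‖ₑ ^ (-β) =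
      ∫⁻ t in Ioi (0 : ℝ), ENNReal.ofReal (t ^ (β / 2 - 1)) *
        ENNReal.ofReal (Real.exp (-(t * ‖x‖ ^ 2))) := by
  have hΓ : 0 < Real.Gamma (β / 2) := Real.Gamma_pos_of_pos (by positivity)
  rcases eq_or_ne x 0 with rfl | hx
  -- At the origin both sides are infinite: a pure power is not integrable on the whole half-line.
  · rw [enorm_zero, ENNReal.zero_rpow_of_neg (neg_lt_zero.2 hβ),
      ENNReal.mul_top (by simpa using hΓ)]
    symm
    by_contra h
    refine not_integrableOn_Ioi_rpow (β / 2 - 1) ⟨?_, ?_⟩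
    · exact Measurable.aestronglyMeasurable (by fun_prop)
    · rw [hasFiniteIntegral_iff_ofReal]
      · refine lt_of_le_of_lt (le_of_eq ?_) (lt_top_iff_ne_top.2 h)
        simp
      · filter_upwards [ae_restrict_mem measurableSet_Ioi] with t (ht : 0 < t)
        exact Real.rpow_nonneg ht.le _
  · have hn : 0 < ‖x‖ := norm_pos_iff.2 hx
    have hI : ∫ t in Ioi (0 : ℝ), t ^ (β / 2 - 1) * Real.exp (-(‖x‖ ^ 2 * t)) =
        Real.Gamma (β / 2) * ‖x‖ ^ (-β) := by
      rw [Real.integral_rpow_mul_exp_neg_mul_Ioi (by positivity) (by positivity), one_div,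
        Real.inv_rpow (by positivity), ← Real.rpow_natCast, ← Real.rpow_mul hn.le,
        Real.rpow_neg hn.le, mul_comm]
      congr 3; push_cast; ring
    have hint : IntegrableOn (fun t : ℝ => t ^ (β / 2 - 1) * Real.exp (-(‖x‖ ^ 2 * t)))
        (Ioi 0) := by
      by_contra h
      rw [integral_undef h] at hI
      exact (mul_pos hΓ (Real.rpow_pos_of_pos hn _)).ne hI
    rw [← ofReal_norm, ENNReal.ofReal_rpow_of_pos hn, ← ENNReal.ofReal_mul hΓ.le, ← hI,
      ofReal_integral_eq_lintegral_ofReal hint]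
    · refine setLIntegral_congr_fun measurableSet_Ioi fun t (ht : 0 < t) => ?_
      rw [ENNReal.ofReal_mul (Real.rpow_nonneg ht.le _), mul_comm (‖x‖ ^ 2)]
    · filter_upwards [ae_restrict_mem measurableSet_Ioi] with t (ht : 0 < t)
      simp only [Pi.zero_apply]
      positivity

/-- The substitution `t ↦ 1 / t`, with Jacobian `t ^ (-2)`, turns this into the Gamma integral `g`.
-/
lemma lintegral_Ioi_rpow_mul_exp_neg_div {p r : ℝ} (hp : 0 < p) (hr : 0 < r) :
    ∫⁻ t in Ioi (0 : ℝ), ENNReal.ofReal (t ^ (-p - 1) * Real.exp (-(r / t))) =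
      ENNReal.ofReal (Real.Gamma p * r ^ (-p)) := by
  let g : ℝ → ℝ := fun y => y ^ (p - 1) * Real.exp (-(r * y))
  have hg : ∫ y in Ioi (0 : ℝ), g y = Real.Gamma p * r ^ (-p) := by
    rw [Real.integral_rpow_mul_exp_neg_mul_Ioi hp hr, one_div, Real.inv_rpow hr.le,
      Real.rpow_neg hr.le, mul_comm]
  have hgi : IntegrableOn g (Ioi 0) := by
    by_contra h
    rw [integral_undef h] at hg
    exact (mul_pos (Real.Gamma_pos_of_pos hp) (Real.rpow_pos_of_pos hr _)).ne hg
  have e : ∀ t ∈ Ioi (0 : ℝ), (|(-1 : ℝ)| * t ^ ((-1 : ℝ) - 1)) • g (t ^ (-1 : ℝ)) =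
      t ^ (-p - 1) * Real.exp (-(r / t)) := fun t (ht : 0 < t) => by
    simp only [g, smul_eq_mul, abs_neg, abs_one, one_mul]
    rw [← Real.rpow_mul ht.le, ← mul_assoc, ← Real.rpow_add ht, Real.rpow_neg_one,
      div_eq_mul_inv]
    congr 2; ring
  have h1 := integral_comp_rpow_Ioi g (p := -1) (by norm_num)
  have h2 := (integrableOn_Ioi_comp_rpow_iff g (p := -1) (by norm_num)).2 hgi
  rw [setIntegral_congr_fun measurableSet_Ioi e, hg] at h1
  rw [integrableOn_congr_fun e measurableSet_Ioi] at h2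
  rw [← h1, ofReal_integral_eq_lintegral_ofReal h2]
  filter_upwards [ae_restrict_mem measurableSet_Ioi] with t (ht : 0 < t)
  simp only [Pi.zero_apply]
  positivity

omit [InnerProductSpace ℝ V] [FiniteDimensional ℝ V] [MeasurableSpace V] [BorelSpace V] in
/-- The Fourier transform of the Riesz kernel as a mixture of Gaussians. -/
lemma lintegral_rpow_mul_exp_neg_norm_sq_div {β : ℝ} {d : ℕ} (hd : β < d) {ξ : V} (hξ : ξ ≠ 0) :
    ∫⁻ t in Ioi (0 : ℝ), ENNReal.ofReal (t ^ (β / 2 - 1)) *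
        (ENNReal.ofReal ((4 * Real.pi * t) ^ (-(d / 2 : ℝ))) *
          ENNReal.ofReal (Real.exp (-(‖ξ‖ ^ 2 / (4 * t))))) =
      ENNReal.ofReal ((4 * Real.pi) ^ (-(d / 2 : ℝ)) * Real.Gamma ((d - β) / 2) *
        4 ^ (((d : ℝ) - β) / 2)) * ‖ξ‖ₑ ^ (β - d) := by
  have hn : 0 < ‖ξ‖ := norm_pos_iff.2 hξ
  have hp : 0 < ((d : ℝ) - β) / 2 := by linarith
  have e : ∀ t ∈ Ioi (0 : ℝ), ENNReal.ofReal (t ^ (β / 2 - 1)) *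
        (ENNReal.ofReal ((4 * Real.pi * t) ^ (-(d / 2 : ℝ))) *
          ENNReal.ofReal (Real.exp (-(‖ξ‖ ^ 2 / (4 * t))))) =
      ENNReal.ofReal ((4 * Real.pi) ^ (-(d / 2 : ℝ))) *
        ENNReal.ofReal (t ^ (-(((d : ℝ) - β) / 2) - 1) *
          Real.exp (-(‖ξ‖ ^ 2 / 4 / t))) := fun t (ht : 0 < t) => by
    rw [← ENNReal.ofReal_mul (by positivity), ← ENNReal.ofReal_mul (by positivity),
      ← ENNReal.ofReal_mul (by positivity), Real.mul_rpow (by positivity) ht.le, div_div]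
    congr 1
    rw [show -(((d : ℝ) - β) / 2) - 1 = (β / 2 - 1) + -(d / 2 : ℝ) by ring, Real.rpow_add ht]
    ring
  rw [setLIntegral_congr_fun measurableSet_Ioi e, lintegral_const_mul' _ _ ENNReal.ofReal_ne_top,
    lintegral_Ioi_rpow_mul_exp_neg_div hp (by positivity), ← ofReal_norm,
    ENNReal.ofReal_rpow_of_pos hn, ← ENNReal.ofReal_mul (by positivity),
    ← ENNReal.ofReal_mul (by have := Real.Gamma_pos_of_pos hp; positivity)]
  congr 1
  rw [Real.div_rpow (by positivity) (by positivity), ← Real.rpow_natCast, ← Real.rpow_mul hn.le,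
    Real.rpow_neg (by norm_num : (0 : ℝ) ≤ 4), div_inv_eq_mul,
    show ((2 : ℕ) : ℝ) * -(((d : ℝ) - β) / 2) = β - d by push_cast; ring]
  ring

/-- **Parseval's formula for Riesz kernels.** For a finite measure whose characteristic function
has a nonnegative real part, the Riesz potential at the origin is a constant multiple of the dual
Riesz integral of the characteristic function. -/
theorem exists_lintegral_enorm_rpow_eq {β : ℝ} (hβ : 0 < β) (hd : β < Module.finrank ℝ V) :
    ∃ c : ℝ≥0∞, c ≠ 0 ∧ c ≠ ∞ ∧ ∀ (ρ : Measure V) [IsFiniteMeasure ρ],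
      (∀ ξ, 0 ≤ (charFun ρ ξ).re) →
      ∫⁻ x, ‖x‖ₑ ^ (-β) ∂ρ =
        c * ∫⁻ ξ, ENNReal.ofReal (charFun ρ ξ).re * ‖ξ‖ₑ ^ (β - Module.finrank ℝ V) := by
  set d := Module.finrank ℝ V with hddef
  have hp : 0 < ((d : ℝ) - β) / 2 := by linarith
  have hΓ : 0 < Real.Gamma (β / 2) := Real.Gamma_pos_of_pos (by positivity)
  have hΓ' : 0 < Real.Gamma ((d - β) / 2) := Real.Gamma_pos_of_pos hp
  set C : ℝ := (4 * Real.pi) ^ (-(d / 2 : ℝ)) * Real.Gamma ((d - β) / 2) *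
        4 ^ (((d : ℝ) - β) / 2) with hC
  have hCpos : 0 < C := by positivity
  refine ⟨(ENNReal.ofReal (Real.Gamma (β / 2)))⁻¹ * ENNReal.ofReal C, ?_, ?_,
    fun ρ _ hρ => ?_⟩
  · simp [hCpos]
  · exact ENNReal.mul_ne_top (by simp [hΓ]) ENNReal.ofReal_ne_top
  have hgauss (t : ℝ) (ht : 0 < t) : ∫⁻ x, ENNReal.ofReal (Real.exp (-(t * ‖x‖ ^ 2))) ∂ρ =
      ∫⁻ ξ, ENNReal.ofReal (charFun ρ ξ).re *
        (ENNReal.ofReal ((4 * Real.pi * t) ^ (-(d / 2 : ℝ))) *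
          ENNReal.ofReal (Real.exp (-(‖ξ‖ ^ 2 / (4 * t))))) := by
    have h := integral_re_charFun_mul_exp_neg ht ρ
    have hpos : 0 < (4 * Real.pi * t) ^ (d / 2 : ℝ) := by positivity
    have hi1 : Integrable (fun x => Real.exp (-(t * ‖x‖ ^ 2))) ρ :=
      Integrable.of_bound (Continuous.aestronglyMeasurable (by fun_prop)) 1
        (.of_forall fun x => by
          rw [Real.norm_eq_abs, Real.abs_exp, Real.exp_le_one_iff]
          nlinarith [sq_nonneg ‖x‖])
    have hi2 : Integrable (fun ξ : V => (4 * Real.pi * t) ^ (-(d / 2 : ℝ)) *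
        ((charFun ρ ξ).re * Real.exp (-(‖ξ‖ ^ 2 / (4 * t))))) := by
      refine Integrable.const_mul ?_ _
      refine (integrable_exp_neg_norm_sq_div ht).bdd_mul (c := ρ.real univ)
        (Complex.measurable_re.comp measurable_charFun).aestronglyMeasurable
        (.of_forall fun ξ => ?_)
      exact (Complex.abs_re_le_norm _).trans (norm_charFun_le ξ)
    have h' : ∫ x, Real.exp (-(t * ‖x‖ ^ 2)) ∂ρ = ∫ ξ : V, (4 * Real.pi * t) ^ (-(d / 2 : ℝ)) *
        ((charFun ρ ξ).re * Real.exp (-(‖ξ‖ ^ 2 / (4 * t)))) := by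
      rw [integral_const_mul, h, ← mul_assoc, Real.rpow_neg (by positivity),
        inv_mul_cancel₀ hpos.ne', one_mul]
    rw [← ofReal_integral_eq_lintegral_ofReal hi1 (.of_forall fun x => (Real.exp_pos _).le), h',
      ofReal_integral_eq_lintegral_ofReal hi2 (.of_forall fun ξ =>
        mul_nonneg (by positivity) (mul_nonneg (hρ ξ) (Real.exp_pos _).le))]
    refine lintegral_congr fun ξ => ?_
    rw [ENNReal.ofReal_mul (by positivity), ENNReal.ofReal_mul (hρ ξ)]
    ring
  have hmain : ENNReal.ofReal (Real.Gamma (β / 2)) * ∫⁻ x, ‖x‖ₑ ^ (-β) ∂ρ =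
      ENNReal.ofReal C * ∫⁻ ξ, ENNReal.ofReal (charFun ρ ξ).re * ‖ξ‖ₑ ^ (β - d) := by
    have hcm : Measurable fun ξ => ENNReal.ofReal (charFun ρ ξ).re :=
      (Complex.measurable_re.comp measurable_charFun).ennreal_ofReal
    rw [← lintegral_const_mul' _ _ ENNReal.ofReal_ne_top,
      ← lintegral_const_mul' _ _ ENNReal.ofReal_ne_top]
    simp_rw [ofReal_Gamma_mul_enorm_rpow hβ]
    rw [lintegral_lintegral_swap (Measurable.aemeasurable (by fun_prop))]
    have e1 : ∀ t ∈ Ioi (0 : ℝ), ∫⁻ x, ENNReal.ofReal (t ^ (β / 2 - 1)) *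
        ENNReal.ofReal (Real.exp (-(t * ‖x‖ ^ 2))) ∂ρ =
        ∫⁻ ξ, ENNReal.ofReal (charFun ρ ξ).re * (ENNReal.ofReal (t ^ (β / 2 - 1)) *
        (ENNReal.ofReal ((4 * Real.pi * t) ^ (-(d / 2 : ℝ))) *
          ENNReal.ofReal (Real.exp (-(‖ξ‖ ^ 2 / (4 * t)))))) := fun t ht => by
      rw [lintegral_const_mul' _ _ ENNReal.ofReal_ne_top, hgauss t ht,
        ← lintegral_const_mul' _ _ ENNReal.ofReal_ne_top]
      exact lintegral_congr fun ξ => by ring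
    rw [setLIntegral_congr_fun measurableSet_Ioi e1, lintegral_lintegral_swap]
    · refine lintegral_congr_ae ?_
      -- From `0 < β < d` the dimension is positive, so the origin, where the mixture formula is not
      -- available, is a null set.
      have : ∀ᵐ ξ : V, ξ ≠ 0 := by
        have : Nontrivial V := Module.finrank_pos_iff.1 (by
          rw [← hddef]; exact_mod_cast hβ.trans hd)
        exact (volume : Measure V).ae_ne 0
      filter_upwards [this] with ξ hξ
      rw [lintegral_const_mul' _ _ ENNReal.ofReal_ne_top,
        lintegral_rpow_mul_exp_neg_norm_sq_div hd hξ]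
      ring
    · refine Measurable.aemeasurable ?_
      refine (hcm.comp measurable_snd).mul ?_
      fun_prop
  rw [mul_assoc, ← hmain, ← mul_assoc, ENNReal.inv_mul_cancel (by simpa using hΓ)
    ENNReal.ofReal_ne_top, one_mul]

end Riesz

/-! ### Discretization of measures of finite energy -/

/-- Nonnegative real weights of total mass greater than `1 / 2` can be rounded down to rationals
of total mass greater than `1 / 2`. -/
lemma exists_rat_weights_le {n : ℕ} {w : ℕ → ℝ} (hw : ∀ i, 0 ≤ w i)
    (h : 1 / 2 < ∑ i ∈ Finset.range n, w i) :
    ∃ q : ℕ → ℚ, (∀ i, 0 ≤ q i) ∧ (∀ i, (q i : ℝ) ≤ w i) ∧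
      1 / 2 < ∑ i ∈ Finset.range n, (q i : ℝ) := by
  -- Rounding down to multiples of `1 / k` loses at most `n / k` in total, which is less than the
  -- excess of the mass over `1 / 2`.
  obtain ⟨k, hk⟩ := exists_nat_gt ((n : ℝ) / (∑ i ∈ Finset.range n, w i - 1 / 2))
  have hpos : 0 < ∑ i ∈ Finset.range n, w i - 1 / 2 := by linarith
  have hk0 : (0 : ℝ) < k := lt_of_le_of_lt (by positivity) hk
  have hkn : (n : ℝ) / k < ∑ i ∈ Finset.range n, w i - 1 / 2 := by
    rw [div_lt_iff₀ hpos] at hk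
    rw [div_lt_iff₀ hk0]
    linarith
  refine ⟨fun i => (⌊w i * k⌋₊ : ℚ) / k, fun i => by positivity, fun i => ?_, ?_⟩
  · push_cast
    rw [div_le_iff₀ hk0]
    exact Nat.floor_le (mul_nonneg (hw i) hk0.le)
  · have h1 (i : ℕ) : w i - 1 / k ≤ (((⌊w i * k⌋₊ : ℚ) / k : ℚ) : ℝ) := by
      push_cast
      rw [le_div_iff₀ hk0, sub_mul, one_div, inv_mul_cancel₀ hk0.ne']
      linarith [Nat.lt_floor_add_one (w i * k)]
    have h2 := Finset.sum_le_sum fun i (_ : i ∈ Finset.range n) => h1 i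
    rw [Finset.sum_sub_distrib, Finset.sum_const, Finset.card_range, nsmul_eq_mul,
      mul_one_div] at h2
    linarith

lemma sum_setLIntegral_le {α : Type*} [MeasurableSpace α] {θ : Measure α} {Q : ℕ → Set α}
    (hQ : ∀ i, MeasurableSet (Q i)) (hd : Pairwise (Function.onFun Disjoint Q)) (n : ℕ)
    (f : α → ℝ≥0∞) : ∑ i ∈ Finset.range n, ∫⁻ x in Q i, f x ∂θ ≤ ∫⁻ x, f x ∂θ := by
  rw [← lintegral_biUnion_finset (fun i _ j _ hij => hd hij) (fun i _ => hQ i)]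
  exact setLIntegral_le_lintegral _ _

/-- Discretization of a measure of finite energy which charges a set `B`. -/
theorem exists_discrete_energy_le {V : Type*} [NormedAddCommGroup V]
    [TopologicalSpace.SeparableSpace V] [MeasurableSpace V] [BorelSpace V]
    {θ : Measure V} (hθ : θ univ ≤ 1) {B : Set V} (hB : 1 / 2 < θ B) {κ : V → ℝ}
    (hκ0 : ∀ x, 0 ≤ κ x) (hκ : UniformContinuous κ) {M : ℝ} (hM : 0 ≤ M)
    (hE : ∫⁻ x, ∫⁻ y, ENNReal.ofReal (κ (x - y)) ∂θ ∂θ ≤ ENNReal.ofReal M)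
    {ε : ℝ} (hε : 0 < ε) :
    ∃ (n : ℕ) (b : ℕ → V) (q : ℕ → ℚ), (∀ i, b i ∈ B) ∧ (∀ i, 0 ≤ q i) ∧
      1 / 2 < ∑ i ∈ Finset.range n, (q i : ℝ) ∧ ∑ i ∈ Finset.range n, (q i : ℝ) ≤ 1 ∧
      ∑ i ∈ Finset.range n, ∑ j ∈ Finset.range n, (q i : ℝ) * q j * κ (b i - b j) ≤ M + ε := by
  have : IsFiniteMeasure θ := ⟨hθ.trans_lt ENNReal.one_lt_top⟩
  obtain ⟨b₀, hb₀⟩ : B.Nonempty := by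
    rw [nonempty_iff_ne_empty]; rintro rfl; simp at hB
  obtain ⟨δ, hδ, hδκ⟩ := Metric.uniformContinuous_iff.1 hκ ε hε
  have : Nonempty V := ⟨b₀⟩
  let e := TopologicalSpace.denseSeq V
  -- With radius `δ / 4`, two points of one cell are less than `δ / 2` apart, so differences of
  -- points from two cells vary by less than `δ`.
  let Q : ℕ → Set V := disjointed fun i => Metric.ball (e i) (δ / 4)
  have hQm (i : ℕ) : MeasurableSet (Q i) := .disjointed (fun _ => Metric.isOpen_ball.measurableSet) i
  have hQd : Pairwise (Function.onFun Disjoint Q) := disjoint_disjointed _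
  have hQb (i : ℕ) : Q i ⊆ Metric.ball (e i) (δ / 4) := disjointed_subset _ i
  have hQu : ⋃ i, Q i = univ := by
    rw [iUnion_disjointed, eq_univ_iff_forall]
    intro x
    obtain ⟨i, hi⟩ := (TopologicalSpace.denseRange_denseSeq V).exists_dist_lt x
      (by positivity : 0 < δ / 4)
    exact mem_iUnion.2 ⟨i, hi⟩
  have hpt (i : ℕ) : ∃ b ∈ B, (Q i ∩ B).Nonempty → b ∈ Q i := by
    by_cases h : (Q i ∩ B).Nonempty
    · exact ⟨h.some, h.some_mem.2, fun _ => h.some_mem.1⟩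
    · exact ⟨b₀, hb₀, fun h' => absurd h' h⟩
  choose b hbB hbQ using hpt
  classical
  -- The set `B` need not be measurable, so `θ B` is an outer measure. A cell that meets `B`
  -- therefore gets its whole mass; subadditivity bounds the total below, and disjointness of the
  -- cells bounds it above.
  let w : ℕ → ℝ≥0∞ := fun i => if (Q i ∩ B).Nonempty then θ (Q i) else 0
  have hwQ (i : ℕ) : w i ≤ θ (Q i) := by
    simp only [w]; split_ifs <;> simp
  have hwt (i : ℕ) : w i ≠ ∞ := ((hwQ i).trans_lt (measure_lt_top _ _)).ne
  have hwB : θ B ≤ ∑' i, w i := by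
    have : B = ⋃ i, (Q i ∩ B) := by rw [← iUnion_inter, hQu, univ_inter]
    calc θ B ≤ ∑' i, θ (Q i ∩ B) := by
          conv_lhs => rw [this]
          exact measure_iUnion_le _
      _ ≤ ∑' i, w i := ENNReal.tsum_le_tsum fun i => by
          simp only [w]
          split_ifs with h
          · exact measure_mono inter_subset_left
          · rw [not_nonempty_iff_eq_empty.1 h, measure_empty]
  obtain ⟨n, hn⟩ : ∃ n, 1 / 2 < ∑ i ∈ Finset.range n, w i := by
    rw [ENNReal.tsum_eq_iSup_nat] at hwB
    exact lt_iSup_iff.1 (hB.trans_le hwB)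
  have hn' : 1 / 2 < ∑ i ∈ Finset.range n, (w i).toReal := by
    rw [← ENNReal.toReal_sum fun i _ => hwt i]
    have := (ENNReal.toReal_lt_toReal (by simp) (ENNReal.sum_ne_top.2 fun i _ => hwt i)).2 hn
    simpa using this
  have hw1 : ∑ i ∈ Finset.range n, (w i).toReal ≤ 1 := by
    rw [← ENNReal.toReal_sum fun i _ => hwt i]
    refine ENNReal.toReal_le_of_le_ofReal zero_le_one ?_
    rw [ENNReal.ofReal_one]
    calc ∑ i ∈ Finset.range n, w i ≤ ∑ i ∈ Finset.range n, θ (Q i) :=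
          Finset.sum_le_sum fun i _ => hwQ i
      _ = θ (⋃ i ∈ Finset.range n, Q i) :=
          (measure_biUnion_finset (fun i _ j _ hij => hQd hij) fun i _ => hQm i).symm
      _ ≤ 1 := (measure_mono (subset_univ _)).trans hθ
  obtain ⟨q, hq0, hqw, hq⟩ := exists_rat_weights_le (fun i => ENNReal.toReal_nonneg) hn'
  refine ⟨n, b, q, hbB, hq0, hq, (Finset.sum_le_sum fun i _ => hqw i).trans hw1, ?_⟩
  have hclose (i j : ℕ) (hi : (Q i ∩ B).Nonempty) (hj : (Q j ∩ B).Nonempty) (x : V) (hx : x ∈ Q i)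
      (y : V) (hy : y ∈ Q j) : κ (b i - b j) ≤ κ (x - y) + ε := by
    have h1 : dist (b i) x < δ / 2 := by
      have := dist_triangle_right (b i) x (e i)
      have h1 := Metric.mem_ball.1 (hQb i (hbQ i hi))
      have h2 := Metric.mem_ball.1 (hQb i hx)
      linarith
    have h2 : dist (b j) y < δ / 2 := by
      have := dist_triangle_right (b j) y (e j)
      have h1 := Metric.mem_ball.1 (hQb j (hbQ j hj))
      have h2 := Metric.mem_ball.1 (hQb j hy)
      linarith
    have h3 : dist (b i - b j) (x - y) < δ :=
      (dist_sub_sub_le _ _ _ _).trans_lt (by linarith)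
    have h4 := hδκ h3
    rw [Real.dist_eq] at h4
    linarith [(abs_lt.1 h4).2]
  have hmain : ∑ i ∈ Finset.range n, ∑ j ∈ Finset.range n,
      w i * (w j * ENNReal.ofReal (κ (b i - b j))) ≤ ENNReal.ofReal (M + ε) := by
    let f : V → V → ℝ≥0∞ := fun x y => ENNReal.ofReal (κ (x - y)) + ENNReal.ofReal ε
    have hstep (i : ℕ) (c : ℝ≥0∞) (g : V → ℝ≥0∞)
        (hc : (Q i ∩ B).Nonempty → ∀ x ∈ Q i, c ≤ g x) : w i * c ≤ ∫⁻ x in Q i, g x ∂θ := by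
      simp only [w]
      split_ifs with h
      · rw [mul_comm, ← setLIntegral_const]
        exact setLIntegral_mono' (hQm i) (hc h)
      · simp
    calc ∑ i ∈ Finset.range n, ∑ j ∈ Finset.range n, w i * (w j * ENNReal.ofReal (κ (b i - b j)))
        ≤ ∑ i ∈ Finset.range n, ∫⁻ x in Q i, ∑ j ∈ Finset.range n, ∫⁻ y in Q j, f x y ∂θ ∂θ := by
          refine Finset.sum_le_sum fun i _ => ?_
          rw [← Finset.mul_sum]
          refine hstep i _ _ fun hi x hx => Finset.sum_le_sum fun j _ => ?_
          refine hstep j _ _ fun hj y hy => ?_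
          simp only [f]
          rw [← ENNReal.ofReal_add (hκ0 _) hε.le]
          exact ENNReal.ofReal_le_ofReal (hclose i j hi hj x hx y hy)
      _ ≤ ∑ i ∈ Finset.range n, ∫⁻ x in Q i, ∫⁻ y, f x y ∂θ ∂θ :=
          Finset.sum_le_sum fun i _ => lintegral_mono fun x => sum_setLIntegral_le hQm hQd n _
      _ ≤ ∫⁻ x, ∫⁻ y, f x y ∂θ ∂θ := sum_setLIntegral_le hQm hQd n _
      _ = ∫⁻ x, ∫⁻ y, ENNReal.ofReal (κ (x - y)) ∂θ ∂θ +
            ENNReal.ofReal ε * θ univ * θ univ := by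
          simp only [f]
          simp_rw [lintegral_add_right _ measurable_const, lintegral_const]
      _ ≤ ENNReal.ofReal M + ENNReal.ofReal ε * 1 * 1 := by gcongr
      _ = ENNReal.ofReal (M + ε) := by rw [mul_one, mul_one, ENNReal.ofReal_add hM hε.le]
  have hreal : ∑ i ∈ Finset.range n, ∑ j ∈ Finset.range n,
      (w i).toReal * (w j).toReal * κ (b i - b j) ≤ M + ε := by
    have h := ENNReal.toReal_le_of_le_ofReal (by linarith) hmain
    rw [ENNReal.toReal_sum fun i _ => ENNReal.sum_ne_top.2 fun j _ => ENNReal.mul_ne_top (hwt i)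
      (ENNReal.mul_ne_top (hwt j) ENNReal.ofReal_ne_top)] at h
    refine le_trans (le_of_eq ?_) h
    refine Finset.sum_congr rfl fun i _ => ?_
    rw [ENNReal.toReal_sum fun j _ => ENNReal.mul_ne_top (hwt i)
      (ENNReal.mul_ne_top (hwt j) ENNReal.ofReal_ne_top)]
    refine Finset.sum_congr rfl fun j _ => ?_
    rw [ENNReal.toReal_mul, ENNReal.toReal_mul, ENNReal.toReal_ofReal (hκ0 _), mul_assoc]
  refine le_trans (Finset.sum_le_sum fun i _ => Finset.sum_le_sum fun j _ => ?_) hreal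
  have h1 : (0 : ℝ) ≤ q i := by exact_mod_cast hq0 i
  have h2 : (0 : ℝ) ≤ q j := by exact_mod_cast hq0 j
  exact mul_le_mul_of_nonneg_right (mul_le_mul (hqw i) (hqw j) h2 ENNReal.toReal_nonneg) (hκ0 _)

/-- The kernel is continuous and vanishes at infinity. Uniformity is what allows one mesh for all
pairs of cells in `exists_discrete_energy_le`. -/
lemma uniformContinuous_regRiesz {V : Type*} [NormedAddCommGroup V] [ProperSpace V] {β ε : ℝ}
    (hβ : 0 < β) (hε : 0 < ε) : UniformContinuous (regRiesz β ε : V → ℝ) := by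
  refine (continuous_regRiesz β hε).uniformContinuous_of_tendsto_cocompact (x := 0) ?_
  have h : Tendsto (fun x : V => ‖x‖ ^ 2 + ε) (cocompact V) atTop :=
    tendsto_atTop_add_const_right _ _
      ((tendsto_pow_atTop two_ne_zero).comp (tendsto_norm_cocompact_atTop (E := V)))
  exact (tendsto_rpow_neg_atTop (by positivity : 0 < β / 2)).comp h

/-! ### Time grids and admissible weights -/

/-- The times `i / (m + 1)`. -/
noncomputable def gridTime (m i : ℕ) : ℝ≥0 := i / (m + 1)

lemma gridTime_mono (m : ℕ) : Monotone (gridTime m) := fun i j h => by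
  unfold gridTime; gcongr

lemma le_gridTime_ceil (m : ℕ) (s : ℝ≥0) : s ≤ gridTime m ⌈(m + 1) * s⌉₊ := by
  unfold gridTime
  rw [le_div_iff₀ (by positivity), mul_comm]
  exact Nat.le_ceil _

lemma gridTime_ceil_le (m : ℕ) (s : ℝ≥0) : gridTime m ⌈(m + 1) * s⌉₊ ≤ s + 1 / (m + 1) := by
  unfold gridTime
  have e : (s + 1 / ((m : ℝ≥0) + 1)) * (m + 1) = (m + 1) * s + 1 := by
    rw [add_mul, one_div, inv_mul_cancel₀ (by positivity), mul_comm s]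
  rw [div_le_iff₀ (by positivity), e]
  exact (Nat.ceil_lt_add_one (by positivity)).le

/-- Times are rounded up because the paths are only right-continuous. -/
lemma tendsto_gridTime_ceil (s : ℝ≥0) :
    Tendsto (fun m : ℕ => gridTime m ⌈(m + 1) * s⌉₊) atTop (𝓝[≥] s) := by
  refine tendsto_nhdsWithin_iff.2 ⟨?_, .of_forall fun m => le_gridTime_ceil m s⟩
  refine tendsto_of_tendsto_of_tendsto_of_le_of_le tendsto_const_nhds ?_
    (fun m => le_gridTime_ceil m s) fun m => gridTime_ceil_le m s
  have := (tendsto_one_div_add_atTop_nhds_zero_nat (𝕜 := ℝ≥0)).const_add s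
  simpa using this

/-- Several points may be rounded to the same grid time `idx b`; their weights are then added up. -/
lemma sum_range_ite_mul {n R : ℕ} {idx : ℕ → ℕ} (h : ∀ b, idx b < R) (q : ℕ → ℝ) (f : ℕ → ℝ) :
    ∑ i ∈ Finset.range R, (∑ b ∈ Finset.range n, if idx b = i then q b else 0) * f i =
      ∑ b ∈ Finset.range n, q b * f (idx b) := by
  simp_rw [Finset.sum_mul, ite_mul, zero_mul]
  rw [Finset.sum_comm]
  refine Finset.sum_congr rfl fun b _ => ?_
  rw [Finset.sum_ite_eq]
  simp [h b]

/-- Admissible weights: finitely supported rational weights on the grid `i / (m + 1)`, `i < R`,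
carried by grid points just to the right of the points of `A`, and of total mass in
`(1 / 2, 1]`. -/
def gridWeights (A : Set ℝ≥0) (m R : ℕ) : Set (ℕ →₀ ℚ) :=
  {p | (∀ i, 0 ≤ p i) ∧
    (∀ i, p i ≠ 0 → ∃ s ∈ A, s ≤ gridTime m i ∧ gridTime m i ≤ s + 1 / (m + 1)) ∧
    1 / 2 < ∑ i ∈ Finset.range R, (p i : ℝ) ∧ ∑ i ∈ Finset.range R, (p i : ℝ) ≤ 1}

/-- The image of `A` carries a good part of a measure of mass at most one and energy at
most `M`. -/
def CarriesEnergy {V : Type*} [NormedAddCommGroup V] [MeasurableSpace V] (β M : ℝ) (B : Set V) :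
    Prop :=
  ∃ θ : Measure V, θ univ ≤ 1 ∧ 1 / 2 < θ B ∧
    ∫⁻ x, ∫⁻ y, ‖x - y‖ₑ ^ (-β) ∂θ ∂θ ≤ ENNReal.ofReal M

/-- Along a right-continuous path, a measure of finite energy on the image of `A` can be replaced
by admissible weights on every sufficiently fine grid. -/
theorem eventually_exists_gridWeights {V : Type*} [NormedAddCommGroup V] [ProperSpace V]
    [MeasurableSpace V] [BorelSpace V] {β : ℝ} (hβ : 0 < β) {x : ℝ≥0 → V}
    (hx : ∀ t, ContinuousWithinAt x (Ici t) t) {A : Set ℝ≥0} {N : ℕ} (hA : A ⊆ Iic (N : ℝ≥0))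
    {M : ℝ} (hM : 0 ≤ M) (h : CarriesEnergy β M (x '' A)) {ε : ℝ} (hε : 0 < ε) :
    ∀ᶠ m : ℕ in atTop, ∃ p ∈ gridWeights A m ((m + 1) * N + 1),
      ∑ i ∈ Finset.range ((m + 1) * N + 1), ∑ j ∈ Finset.range ((m + 1) * N + 1),
        (p i : ℝ) * p j * regRiesz β ε (x (gridTime m i) - x (gridTime m j)) < M + 1 := by
  obtain ⟨θ, hθ1, hθA, hθE⟩ := h
  -- The discretization error `1 / 2` keeps the limiting energy strictly below `M + 1`, so the
  -- strict bound already holds on all fine grids.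
  obtain ⟨n, b, q, hbA, hq0, hq, hq1, hE⟩ := exists_discrete_energy_le hθ1 hθA
    (regRiesz_nonneg β hε) (uniformContinuous_regRiesz hβ hε) hM
    (hθE.trans' (lintegral_mono fun _ => lintegral_mono fun _ => ofReal_regRiesz_le hβ hε _))
    (by norm_num : (0 : ℝ) < 1 / 2)
  choose s hsA hsb using hbA
  have hlim : Tendsto (fun m : ℕ => ∑ i ∈ Finset.range n, ∑ j ∈ Finset.range n,
      (q i : ℝ) * q j * regRiesz β ε (x (gridTime m ⌈(m + 1) * s i⌉₊) -
        x (gridTime m ⌈(m + 1) * s j⌉₊))) atTop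
      (𝓝 (∑ i ∈ Finset.range n, ∑ j ∈ Finset.range n,
        (q i : ℝ) * q j * regRiesz β ε (b i - b j))) := by
    have hxb (i : ℕ) : Tendsto (fun m : ℕ => x (gridTime m ⌈(m + 1) * s i⌉₊)) atTop
        (𝓝 (b i)) := by
      rw [← hsb i]
      exact (hx (s i)).tendsto.comp (tendsto_gridTime_ceil (s i))
    refine tendsto_finsetSum _ fun i _ => tendsto_finsetSum _ fun j _ => ?_
    exact (((continuous_regRiesz β hε).tendsto _).comp ((hxb i).sub (hxb j))).const_mul _
  filter_upwards [hlim.eventually_lt_const (by linarith : _ < M + 1)] with m hm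
  set R := (m + 1) * N + 1 with hR
  let idx : ℕ → ℕ := fun i => ⌈(m + 1) * s i⌉₊
  have hidx (i : ℕ) : idx i < R := by
    refine Nat.lt_succ_of_le (Nat.ceil_le.2 ?_)
    push_cast
    gcongr
    exact hA (hsA i)
  let p : ℕ →₀ ℚ := ∑ b ∈ Finset.range n, Finsupp.single (idx b) (q b)
  have hp (i : ℕ) : p i = ∑ b ∈ Finset.range n, if idx b = i then q b else 0 := by
    simp only [p, Finsupp.finsetSum_apply, Finsupp.single_apply]
  have hpr (i : ℕ) : (p i : ℝ) = ∑ b ∈ Finset.range n, if idx b = i then (q b : ℝ) else 0 := by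
    rw [hp]; push_cast; exact Finset.sum_congr rfl fun b _ => by split_ifs <;> simp
  have hsum : ∑ i ∈ Finset.range R, (p i : ℝ) = ∑ i ∈ Finset.range n, (q i : ℝ) := by
    have := sum_range_ite_mul (n := n) hidx (fun b => (q b : ℝ)) fun _ => 1
    simp only [mul_one] at this
    simp_rw [hpr, this]
  refine ⟨p, ⟨fun i => ?_, fun i hi => ?_, by rwa [hsum], by rwa [hsum]⟩, ?_⟩
  · rw [hp]
    exact Finset.sum_nonneg fun b _ => by split_ifs <;> simp [hq0]
  · rw [hp] at hi
    obtain ⟨b, -, hb⟩ := Finset.exists_ne_zero_of_sum_ne_zero hi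
    have hb' : idx b = i := by
      by_contra h; simp [h] at hb
    exact ⟨s b, hsA b, hb' ▸ le_gridTime_ceil m (s b), hb' ▸ gridTime_ceil_le m (s b)⟩
  · refine lt_of_eq_of_lt ?_ hm
    simp_rw [mul_assoc, ← Finset.mul_sum, hpr]
    rw [sum_range_ite_mul hidx]
    refine Finset.sum_congr rfl fun b _ => ?_
    rw [sum_range_ite_mul hidx]

/-! ### Independence of increments from the past -/

section Increments

variable {Ω V : Type*} {m0 : MeasurableSpace Ω} {P : Measure Ω} [MeasurableSpace V]

/-- The filtration generated by a sequence of random variables, strictly before time `i`. -/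
def strictPast (Y : ℕ → Ω → V) (hY : ∀ l, Measurable (Y l)) : Filtration ℕ m0 where
  seq i := ⨆ l ∈ Finset.range i, MeasurableSpace.comap (Y l) inferInstance
  mono' i j hij := by
    refine iSup₂_le fun l hl => le_iSup₂_of_le l ?_ le_rfl
    exact Finset.range_mono hij hl
  le' i := iSup₂_le fun l _ => (hY l).comap_le

lemma measurable_strictPast {Y : ℕ → Ω → V} (hY : ∀ l, Measurable (Y l)) {l i : ℕ} (h : l < i) :
    Measurable[strictPast Y hY i] (Y l) :=
  Measurable.of_comap_le (le_iSup₂_of_le (f := fun l (_ : l ∈ Finset.range i) =>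
    MeasurableSpace.comap (Y l) inferInstance) l (Finset.mem_range.2 h) le_rfl)

/-- For independent random variables, the strict past of `i` is independent of every function of
the variables with index in `[i, j)`. -/
lemma indep_strictPast {Y : ℕ → Ω → V} (hY : ∀ l, Measurable (Y l)) (h : iIndepFun Y P)
    {i j : ℕ} {g : (Finset.Ico i j → V) → ℝ} (hg : Measurable g) :
    Indep (strictPast Y hY i)
      (MeasurableSpace.comap (fun ω => g fun l => Y l ω) inferInstance) P := by
  have hdisj : Disjoint (Finset.range i) (Finset.Ico i j) := by
    rw [Finset.disjoint_left]
    intro l h1 h2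
    simp only [Finset.mem_range, Finset.mem_Ico] at h1 h2
    omega
  have hI := h.indepFun_finset _ _ hdisj hY
  rw [IndepFun_iff_Indep] at hI
  refine indep_of_indep_of_le_left (indep_of_indep_of_le_right hI ?_) ?_
  · have : (fun ω => g fun l => Y l ω) = g ∘ fun ω (l : Finset.Ico i j) => Y l ω := rfl
    rw [this, ← MeasurableSpace.comap_comp]
    exact MeasurableSpace.comap_mono hg.comap_le
  · refine iSup₂_le fun l hl => ?_
    have : Y l = (fun v : Finset.range i → V => v ⟨l, hl⟩) ∘
        fun ω (l : Finset.range i) => Y l ω := rfl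
    rw [this, ← MeasurableSpace.comap_comp]
    exact MeasurableSpace.comap_mono (measurable_pi_apply _).comap_le

end Increments

/-! ### From random weights to deterministic measures on grids -/

section Energy

variable {Ω V : Type*} {m0 : MeasurableSpace Ω} {P : Measure Ω} [IsProbabilityMeasure P]
  [NormedAddCommGroup V] [InnerProductSpace ℝ V] [FiniteDimensional ℝ V]
  [MeasurableSpace V] [BorelSpace V] {X : ℝ≥0 → Ω → V}

/-- The energy of the mean of a random weight on a grid is controlled by its mean energy. -/
theorem sum_sum_mean_regRiesz_le (hX : ∀ t, Measurable (X t)) (hind : HasIndepIncrements X P)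
    {β ε : ℝ} (hβ : 0 < β) (hε : 0 < ε) {τ : ℕ → ℝ≥0} (hτ : Monotone τ) {a : ℕ → Ω → ℝ}
    (ha : ∀ i, Measurable (a i)) (ha0 : ∀ i ω, 0 ≤ a i ω) (ha1 : ∀ i ω, a i ω ≤ 1) (n : ℕ) :
    ∑ i ∈ Finset.range n, ∑ j ∈ Finset.range n,
      P[a i] * P[a j] * P[fun ω => regRiesz β ε (X (τ i) ω - X (τ j) ω)] ≤
    16 * ∑ i ∈ Finset.range n, ∑ j ∈ Finset.range n,
      P[fun ω => a i ω * a j ω * regRiesz β ε (X (τ i) ω - X (τ j) ω)] := by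
  let Y : ℕ → Ω → V := fun l ω => X (τ (l + 1)) ω - X (τ l) ω
  have hY (l : ℕ) : Measurable (Y l) := (hX _).sub (hX _)
  have hsum (i j : ℕ) (hij : i ≤ j) (ω : Ω) :
      X (τ i) ω - X (τ j) ω = -∑ l ∈ (Finset.Ico i j).attach, Y l ω := by
    rw [Finset.sum_attach (Finset.Ico i j) fun l => Y l ω,
      Finset.sum_Ico_sub (fun l => X (τ l) ω) hij, neg_sub]
  have hκ : Continuous (regRiesz β ε : V → ℝ) := continuous_regRiesz β hε
  refine sum_sum_mean_le (F := strictPast Y hY) (C := ε ^ (-(β / 2)))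
    (fun i j ω => by rw [← neg_sub, regRiesz_neg]) (fun i j ω => regRiesz_nonneg β hε _)
    (fun i j ω => regRiesz_le hβ hε _)
    (fun n ω c => sum_sum_regRiesz_nonneg hβ hε n c fun i => X (τ i) ω)
    (fun i j hij => ?_) (fun i j hij => ?_) ha ha0 ha1 n
  · refine hκ.comp_stronglyMeasurable (Measurable.stronglyMeasurable ?_)
    simp_rw [hsum i j hij]
    refine (Finset.measurable_sum _ fun l _ => ?_).neg
    exact measurable_strictPast hY (Finset.mem_Ico.1 l.2).2
  · simp_rw [hsum i j hij]
    refine indep_strictPast hY (hind.nat hτ) (i := i) (j := j)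
      (g := fun v => regRiesz β ε (-∑ l ∈ (Finset.Ico i j).attach, v l)) ?_
    refine hκ.measurable.comp ?_
    exact (Finset.measurable_sum _ fun l _ => measurable_pi_apply l).neg

/-- The random paths with admissible weights of small energy on a given grid. -/
def lightGrid (X : ℝ≥0 → Ω → V) (β ε M : ℝ) (m R : ℕ) (p : ℕ →₀ ℚ) : Set Ω :=
  {ω | ∑ i ∈ Finset.range R, ∑ j ∈ Finset.range R,
    (p i : ℝ) * p j * regRiesz β ε (X (gridTime m i) ω - X (gridTime m j) ω) < M}

omit [InnerProductSpace ℝ V] [FiniteDimensional ℝ V] in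
lemma measurableSet_lightGrid [SecondCountableTopology V] (hX : ∀ t, Measurable (X t))
    {β ε : ℝ} (hε : 0 < ε) (M : ℝ) (m R : ℕ) (p : ℕ →₀ ℚ) :
    MeasurableSet (lightGrid X β ε M m R p) := by
  refine measurableSet_lt (Finset.measurable_sum _ fun i _ => Finset.measurable_sum _
    fun j _ => ?_) measurable_const
  exact ((continuous_regRiesz β hε).measurable.comp ((hX _).sub (hX _))).const_mul _

/-- If admissible weights of small energy exist with probability at least `c`, their mean gives
deterministic weights of small mean energy. -/
theorem exists_mean_weights (hX : ∀ t, Measurable (X t)) (hind : HasIndepIncrements X P)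
    {β ε : ℝ} (hβ : 0 < β) (hε : 0 < ε) {M : ℝ} (hM : 0 ≤ M) {A : Set ℝ≥0} {m R : ℕ} {c : ℝ}
    (hP : ENNReal.ofReal c < P (⋃ p ∈ gridWeights A m R, lightGrid X β ε M m R p)) :
    ∃ w : ℕ → ℝ, (∀ i, 0 ≤ w i) ∧
      (∀ i, w i ≠ 0 → ∃ s ∈ A, s ≤ gridTime m i ∧ gridTime m i ≤ s + 1 / (m + 1)) ∧
      c / 2 ≤ ∑ i ∈ Finset.range R, w i ∧
      ∑ i ∈ Finset.range R, ∑ j ∈ Finset.range R, w i * w j *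
        P[fun ω => regRiesz β ε (X (gridTime m i) ω - X (gridTime m j) ω)] ≤ 16 * M := by
  classical
  set W := gridWeights A m R with hW
  set D := ⋃ p ∈ W, lightGrid X β ε M m R p with hD
  have hWne : W.Nonempty := by
    rw [nonempty_iff_ne_empty]
    intro h
    rw [hD, h] at hP
    simp at hP
  obtain ⟨e, he⟩ := (to_countable W).exists_eq_range hWne
  have heW (n : ℕ) : e n ∈ W := he ▸ mem_range_self n
  have hDm : MeasurableSet D :=
    MeasurableSet.biUnion (to_countable W) fun p _ => measurableSet_lightGrid hX hε M m R p
  -- The rational weights are enumerated and the first one that works is selected, which is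
  -- measurable in `ω`. Adding `Dᶜ` makes the search succeed on every path.
  have hex (ω : Ω) : ∃ n, ω ∈ lightGrid X β ε M m R (e n) ∪ Dᶜ := by
    by_cases hω : ω ∈ D
    · obtain ⟨p, hp, hωp⟩ := mem_iUnion₂.1 hω
      obtain ⟨n, rfl⟩ : p ∈ range e := he ▸ hp
      exact ⟨n, Or.inl hωp⟩
    · exact ⟨0, Or.inr hω⟩
  have hlm := measurable_find hex fun n =>
    (measurableSet_lightGrid hX hε M m R (e n)).union hDm.compl
  set l : Ω → ℕ := fun ω => Nat.find (hex ω) with hl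
  have hlD (ω : Ω) (hω : ω ∈ D) : ω ∈ lightGrid X β ε M m R (e (l ω)) :=
    (Nat.find_spec (hex ω)).resolve_right fun h => h hω
  let a : ℕ → Ω → ℝ := fun i => D.indicator fun ω => ((e (l ω) i : ℚ) : ℝ)
  have ha (i : ℕ) : Measurable (a i) :=
    ((measurable_from_nat (f := fun n => ((e n i : ℚ) : ℝ))).comp hlm).indicator hDm
  have hR (n i : ℕ) : 0 ≤ ((e n i : ℚ) : ℝ) := by exact_mod_cast (heW n).1 i
  have ha0 (i : ℕ) (ω : Ω) : 0 ≤ a i ω := indicator_nonneg (fun ω _ => hR _ _) ω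
  -- Admissibility bounds the total mass by 1 only for indices below `R`, so the weights are cut off
  -- there.
  let a' : ℕ → Ω → ℝ := fun i => if i < R then a i else 0
  have haa (i : ℕ) (hi : i ∈ Finset.range R) : a' i = a i := if_pos (Finset.mem_range.1 hi)
  have ha1 (i : ℕ) (ω : Ω) : a' i ω ≤ 1 := by
    simp only [a']
    split_ifs with hi
    · refine indicator_apply_le' (fun _ => ?_) fun _ => zero_le_one
      refine le_trans ?_ (heW (l ω)).2.2.2
      exact Finset.single_le_sum (f := fun i => ((e (l ω) i : ℚ) : ℝ)) (fun i _ => hR _ i)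
        (Finset.mem_range.2 hi)
    · exact zero_le_one
  have ham (i : ℕ) : Measurable (a' i) := by
    simp only [a']; split_ifs
    · exact ha i
    · exact measurable_const
  have ha0' (i : ℕ) (ω : Ω) : 0 ≤ a' i ω := by
    simp only [a']; split_ifs
    · exact ha0 i ω
    · exact le_rfl
  have hai (i : ℕ) : Integrable (a' i) P :=
    Integrable.of_bound (ham i).aestronglyMeasurable 1 (.of_forall fun ω => by
      rw [Real.norm_eq_abs, abs_of_nonneg (ha0' i ω)]; exact ha1 i ω)
  refine ⟨fun i => P[a' i], fun i => integral_nonneg (ha0' i), fun i hi => ?_, ?_, ?_⟩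
  · obtain ⟨ω, hω⟩ : ∃ ω, a' i ω ≠ 0 := by
      by_contra! h
      exact hi (by simp [h])
    simp only [a'] at hω
    split_ifs at hω with hiR
    · have hωD : ω ∈ D := mem_of_indicator_ne_zero hω
      simp only [a, indicator_of_mem hωD] at hω
      exact (heW (l ω)).2.1 i (by exact_mod_cast hω)
    · simp at hω
  · rw [← integral_finsetSum _ fun i _ => hai i]
    have h1 : ∫ ω, D.indicator (fun _ => (1 / 2 : ℝ)) ω ∂P ≤
        ∫ ω, ∑ i ∈ Finset.range R, a' i ω ∂P := by
      refine integral_mono ((integrable_const _).indicator hDm)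
        (integrable_finsetSum _ fun i _ => hai i) fun ω => ?_
      refine indicator_apply_le' (fun hω => ?_) fun _ => Finset.sum_nonneg fun i _ => ha0' i ω
      rw [Finset.sum_congr rfl fun i hi => congrFun (haa i hi) ω]
      simp only [a, indicator_of_mem hω]
      exact (heW (l ω)).2.2.1.le
    rw [integral_indicator_const _ hDm] at h1
    have h2 : c ≤ P.real D := by
      rw [Measure.real, ← ENNReal.ofReal_le_iff_le_toReal (measure_ne_top _ _)]
      exact hP.le
    refine le_trans ?_ h1
    rw [smul_eq_mul]
    linarith
  · refine (sum_sum_mean_regRiesz_le hX hind hβ hε (gridTime_mono m) ham ha0' ha1 R).trans ?_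
    refine mul_le_mul_of_nonneg_left ?_ (by norm_num)
    have hint (i j : ℕ) : Integrable (fun ω => a' i ω * a' j ω *
        regRiesz β ε (X (gridTime m i) ω - X (gridTime m j) ω)) P := by
      refine Integrable.of_bound (((ham i).mul (ham j)).mul ((continuous_regRiesz β
        hε).measurable.comp ((hX _).sub (hX _)))).aestronglyMeasurable (ε ^ (-(β / 2)))
        (.of_forall fun ω => ?_)
      rw [Real.norm_eq_abs, abs_of_nonneg (mul_nonneg (mul_nonneg (ha0' i ω) (ha0' j ω))
        (regRiesz_nonneg β hε _))]
      calc _ ≤ 1 * regRiesz β ε (X (gridTime m i) ω - X (gridTime m j) ω) :=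
            mul_le_mul_of_nonneg_right (mul_le_one₀ (ha1 i ω) (ha0' j ω) (ha1 j ω))
              (regRiesz_nonneg β hε _)
        _ ≤ _ := by rw [one_mul]; exact regRiesz_le hβ hε _
    rw [← Finset.sum_congr rfl fun i _ => integral_finsetSum _ fun j _ => hint i j,
      ← integral_finsetSum _ fun i _ => integrable_finsetSum _ fun j _ => hint i j]
    have h : ∫ ω, ∑ i ∈ Finset.range R, ∑ j ∈ Finset.range R, a' i ω * a' j ω *
        regRiesz β ε (X (gridTime m i) ω - X (gridTime m j) ω) ∂P ≤ ∫ _, M ∂P := by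
      refine integral_mono (integrable_finsetSum _ fun i _ => integrable_finsetSum _ fun j _ =>
        hint i j) (integrable_const _) fun ω => ?_
      have e1 : ∑ i ∈ Finset.range R, ∑ j ∈ Finset.range R, a' i ω * a' j ω *
          regRiesz β ε (X (gridTime m i) ω - X (gridTime m j) ω) =
          ∑ i ∈ Finset.range R, ∑ j ∈ Finset.range R, a i ω * a j ω *
          regRiesz β ε (X (gridTime m i) ω - X (gridTime m j) ω) :=
        Finset.sum_congr rfl fun i hi => Finset.sum_congr rfl fun j hj => by
          rw [haa i hi, haa j hj]
      simp only
      rw [e1]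
      by_cases hω : ω ∈ D
      · simp only [a, indicator_of_mem hω]
        exact (hlD ω hω).le
      · simp only [a, indicator_of_notMem hω]
        simpa using hM
    simpa using h

/-- If the image of `A` carries energy at most `M` with positive probability, there are
deterministic probability measures arbitrarily close to `A` with bounded mean energy. -/
theorem exists_probabilityMeasure_energy_le (hX : ∀ t, Measurable (X t))
    (hrc : ∀ ω t, ContinuousWithinAt (fun s => X s ω) (Ici t) t)
    (hind : HasIndepIncrements X P) {β ε : ℝ} (hβ : 0 < β) (hε : 0 < ε) {M : ℝ} (hM : 0 ≤ M)
    {A : Set ℝ≥0} {N : ℕ} (hA : A ⊆ Iic (N : ℝ≥0)) {c : ℝ} (hc : 0 < c)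
    (hP : ENNReal.ofReal c < P {ω | CarriesEnergy β M ((fun t => X t ω) '' A)})
    {δ : ℝ} (hδ : 0 < δ) :
    ∃ ν : ProbabilityMeasure ℝ≥0, (ν : Measure ℝ≥0) (Metric.cthickening δ A) = 1 ∧
      ∫ s, ∫ t, P[fun ω => regRiesz β ε (X s ω - X t ω)] ∂(ν : Measure ℝ≥0) ∂(ν : Measure ℝ≥0) ≤
        64 * (M + 1) / c ^ 2 := by
  let D : ℕ → Set Ω := fun m => ⋃ p ∈ gridWeights A m ((m + 1) * N + 1),
    lightGrid X β ε (M + 1) m ((m + 1) * N + 1) p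
  have hsub : {ω | CarriesEnergy β M ((fun t => X t ω) '' A)} ⊆ ⋃ k, ⋂ m ≥ k, D m := by
    intro ω hω
    obtain ⟨k, hk⟩ := eventually_atTop.1
      (eventually_exists_gridWeights hβ (hrc ω) hA hM hω hε)
    refine mem_iUnion.2 ⟨k, mem_iInter₂.2 fun m hm => ?_⟩
    obtain ⟨p, hp, hpE⟩ := hk m hm
    exact mem_iUnion₂.2 ⟨p, hp, hpE⟩
  have hmono : Monotone fun k => ⋂ m ≥ k, D m := fun k k' h =>
    biInter_mono (fun m (hm : k' ≤ m) => h.trans hm) fun _ _ => le_rfl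
  obtain ⟨k, hk⟩ : ∃ k, ENNReal.ofReal c < P (⋂ m ≥ k, D m) := by
    have := hP.trans_le (measure_mono hsub)
    rw [hmono.measure_iUnion] at this
    exact lt_iSup_iff.1 this
  obtain ⟨m, hmk, hmδ⟩ : ∃ m ≥ k, 1 / ((m : ℝ) + 1) ≤ δ := by
    have := (tendsto_one_div_add_atTop_nhds_zero_nat (𝕜 := ℝ)).eventually_le_const hδ
    exact ((eventually_ge_atTop k).and this).exists
  set R := (m + 1) * N + 1
  obtain ⟨w, hw0, hwA, hwc, hwE⟩ := exists_mean_weights hX hind hβ hε (by linarith : 0 ≤ M + 1)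
    (hk.trans_le (measure_mono (biInter_subset_of_mem hmk)))
  set S := ∑ i ∈ Finset.range R, w i with hS
  have hSpos : 0 < S := by linarith
  let v : ℕ → ℝ≥0∞ := fun i => ENNReal.ofReal (w i / S)
  let ν : Measure ℝ≥0 := ∑ i ∈ Finset.range R, v i • Measure.dirac (gridTime m i)
  have hv0 (i : ℕ) : 0 ≤ w i / S := div_nonneg (hw0 i) hSpos.le
  have hvsum : ∑ i ∈ Finset.range R, v i = 1 := by
    rw [← ENNReal.ofReal_sum_of_nonneg fun i _ => hv0 i, ← Finset.sum_div, div_self hSpos.ne',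
      ENNReal.ofReal_one]
  have hνapp (T : Set ℝ≥0) (hT : MeasurableSet T)
      (h : ∀ i, w i ≠ 0 → gridTime m i ∈ T) : ν T = 1 := by
    rw [Measure.finsetSum_apply, ← hvsum]
    refine Finset.sum_congr rfl fun i _ => ?_
    rw [Measure.smul_apply, Measure.dirac_apply' _ hT, smul_eq_mul]
    by_cases hi : w i = 0
    · simp [v, hi]
    · simp [h i hi]
  have hνint (f : ℝ≥0 → ℝ) : ∫ s, f s ∂ν = ∑ i ∈ Finset.range R, w i / S * f (gridTime m i) := by
    rw [integral_finsetSum_measure fun i _ =>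
      (integrable_dirac (by simp)).smul_measure ENNReal.ofReal_ne_top]
    refine Finset.sum_congr rfl fun i _ => ?_
    rw [integral_smul_measure, integral_dirac, ENNReal.toReal_ofReal (hv0 i), smul_eq_mul]
  refine ⟨⟨ν, ⟨hνapp univ .univ fun _ _ => mem_univ _⟩⟩, ?_, ?_⟩
  · refine hνapp _ Metric.isClosed_cthickening.measurableSet fun i hi => ?_
    obtain ⟨s, hs, h1, h2⟩ := hwA i hi
    refine Metric.mem_cthickening_of_dist_le _ s δ A hs ?_
    rw [NNReal.dist_eq]
    have h1' : (s : ℝ) ≤ gridTime m i := by exact_mod_cast h1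
    have h2' : (gridTime m i : ℝ) ≤ s + 1 / (m + 1) := by exact_mod_cast h2
    rw [abs_of_nonneg (by linarith)]
    linarith
  · simp only [ProbabilityMeasure.coe_mk]
    simp_rw [hνint, Finset.mul_sum]
    have e : ∑ i ∈ Finset.range R, ∑ j ∈ Finset.range R, w i / S * (w j / S *
        P[fun ω => regRiesz β ε (X (gridTime m i) ω - X (gridTime m j) ω)]) =
        (∑ i ∈ Finset.range R, ∑ j ∈ Finset.range R, w i * w j *
        P[fun ω => regRiesz β ε (X (gridTime m i) ω - X (gridTime m j) ω)]) / S ^ 2 := by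
      simp_rw [Finset.sum_div]
      refine Finset.sum_congr rfl fun i _ => Finset.sum_congr rfl fun j _ => ?_
      field_simp
    rw [e, div_le_div_iff₀ (by positivity) (by positivity)]
    -- Normalizing by the total mass `S ≥ c / 2` divides the energy bound `16 * (M + 1)` by `S ^ 2`,
    -- whence the constant 64.
    have h4 : c ^ 2 ≤ 4 * S ^ 2 := by nlinarith
    have hM1 : 0 ≤ 16 * (M + 1) := by linarith
    calc _ ≤ 16 * (M + 1) * c ^ 2 := mul_le_mul_of_nonneg_right hwE (sq_nonneg c)
      _ ≤ 16 * (M + 1) * (4 * S ^ 2) := mul_le_mul_of_nonneg_left h4 hM1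
      _ = _ := by ring

end Energy

/-! ### Passage to the limit -/

lemma CarriesEnergy.mono {V : Type*} [NormedAddCommGroup V] [MeasurableSpace V] {β M M' : ℝ}
    {B B' : Set V} (h : CarriesEnergy β M B) (hB : B ⊆ B') (hM : M ≤ M') :
    CarriesEnergy β M' B' := by
  obtain ⟨θ, h1, h2, h3⟩ := h
  exact ⟨θ, h1, h2.trans_le (measure_mono hB), h3.trans (ENNReal.ofReal_le_ofReal hM)⟩

/-- Outer measure is continuous along increasing unions of arbitrary sets, so the open condition `1
/ 2 < θ B` is already met at a finite stage, with the same `θ`. Requiring full mass would not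
survive this; hence the threshold in `CarriesEnergy`. -/
lemma carriesEnergy_iUnion {V : Type*} [NormedAddCommGroup V] [MeasurableSpace V] {β M : ℝ}
    {S : ℕ → Set V} (hS : Monotone S) :
    CarriesEnergy β M (⋃ n, S n) ↔ ∃ n, CarriesEnergy β M (S n) := by
  refine ⟨fun ⟨θ, h1, h2, h3⟩ => ?_, fun ⟨n, h⟩ => h.mono (subset_iUnion S n) le_rfl⟩
  rw [hS.measure_iUnion] at h2
  obtain ⟨n, hn⟩ := lt_iSup_iff.1 h2
  exact ⟨n, θ, h1, hn, h3⟩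

/-- Tight sequences of probability measures have limits along some nontrivial filter. -/
lemma exists_tendsto_of_forall_compl_eq_zero {α : Type*} [TopologicalSpace α] [T2Space α]
    [NormalSpace α] [MeasurableSpace α] [BorelSpace α] (ν : ℕ → ProbabilityMeasure α) {K : Set α}
    (hK : IsCompact K) (h : ∀ n, (ν n : Measure α) Kᶜ = 0) :
    ∃ (L : Filter ℕ) (μ : ProbabilityMeasure α), L.NeBot ∧ L ≤ atTop ∧ Tendsto ν L (𝓝 μ) := by
  have hT : IsTightMeasureSet {((μ : ProbabilityMeasure α) : Measure α) | μ ∈ range ν} := by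
    rw [isTightMeasureSet_iff_exists_isCompact_measure_compl_le]
    refine fun ε _ => ⟨K, hK, ?_⟩
    rintro _ ⟨_, ⟨n, rfl⟩, rfl⟩
    rw [h n]
    exact zero_le
  have hC := isCompact_closure_of_isTightMeasureSet hT
  -- An ultrafilter finer than `atTop` replaces the choice of a convergent subsequence.
  obtain ⟨μ, -, hμ⟩ := hC.ultrafilter_le_nhds (Ultrafilter.map ν (Ultrafilter.of atTop))
    (by
      rw [le_principal_iff]
      exact mem_of_superset (Filter.mem_map.2 (univ_mem' fun n => mem_range_self n))
        subset_closure)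
  exact ⟨(Ultrafilter.of atTop : Ultrafilter ℕ), μ, inferInstance, Ultrafilter.of_le _, hμ⟩

section Limit

variable {Ω V : Type*} {m0 : MeasurableSpace Ω} {P : Measure Ω} [IsProbabilityMeasure P]
  [NormedAddCommGroup V] [InnerProductSpace ℝ V] [FiniteDimensional ℝ V]
  [MeasurableSpace V] [BorelSpace V] {X : ℝ≥0 → Ω → V}

omit [InnerProductSpace ℝ V] [FiniteDimensional ℝ V] [MeasurableSpace V] [BorelSpace V] in
lemma mean_regRiesz_le {β ε : ℝ} (hβ : 0 < β) (hε : 0 < ε) (Z : Ω → V) :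
    P[fun ω => regRiesz β ε (Z ω)] ≤ ε ^ (-(β / 2)) := by
  by_cases hZ : Integrable (fun ω => regRiesz β ε (Z ω)) P
  · have := integral_mono hZ (integrable_const (ε ^ (-(β / 2)))) fun ω => regRiesz_le hβ hε (Z ω)
    simpa using this
  · rw [integral_undef hZ]; positivity

/-- Weak limits preserve a uniform bound on regularized energies. -/
lemma lintegral_enorm_rpow_le_of_tendsto (hX : ∀ t, Measurable (X t)) {β : ℝ} (hβ : 0 < β)
    (hcont : ∀ ε : ℝ, 0 < ε →
      Continuous fun p : ℝ≥0 × ℝ≥0 => P[fun ω => regRiesz β ε (X p.1 ω - X p.2 ω)])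
    {ν : ℕ → ProbabilityMeasure ℝ≥0} {μ : ProbabilityMeasure ℝ≥0} {L : Filter ℕ} [L.NeBot]
    (hL : L ≤ atTop) (hlim : Tendsto ν L (𝓝 μ)) {C : ℝ}
    (hC : ∀ n : ℕ, ∫ s, ∫ t, P[fun ω => regRiesz β (1 / ((n : ℝ) + 1)) (X s ω - X t ω)]
      ∂(ν n : Measure ℝ≥0) ∂(ν n : Measure ℝ≥0) ≤ C) :
    ∫⁻ p, ∫⁻ ω, ‖X p.1 ω - X p.2 ω‖ₑ ^ (-β) ∂P ∂((μ : Measure ℝ≥0).prod (μ : Measure ℝ≥0)) ≤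
      ENNReal.ofReal C := by
  have hε (n : ℕ) : 0 < 1 / ((n : ℝ) + 1) := by positivity
  let k : ℕ → ℝ≥0 × ℝ≥0 → ℝ := fun n p =>
    P[fun ω => regRiesz β (1 / ((n : ℝ) + 1)) (X p.1 ω - X p.2 ω)]
  have hk0 (n : ℕ) (p : ℝ≥0 × ℝ≥0) : 0 ≤ k n p :=
    integral_nonneg fun ω => regRiesz_nonneg β (hε n) _
  have hkm (n : ℕ) (p : ℝ≥0 × ℝ≥0) :
      Measurable fun ω => regRiesz β (1 / ((n : ℝ) + 1)) (X p.1 ω - X p.2 ω) :=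
    (continuous_regRiesz β (hε n)).measurable.comp ((hX _).sub (hX _))
  have hki (n : ℕ) (p : ℝ≥0 × ℝ≥0) :
      Integrable (fun ω => regRiesz β (1 / ((n : ℝ) + 1)) (X p.1 ω - X p.2 ω)) P :=
    Integrable.of_bound (hkm n p).aestronglyMeasurable _ (.of_forall fun ω => by
      rw [Real.norm_eq_abs, abs_of_nonneg (regRiesz_nonneg β (hε n) _)]
      exact regRiesz_le hβ (hε n) _)
  have hεa {m n : ℕ} (h : m ≤ n) : 1 / ((n : ℝ) + 1) ≤ 1 / ((m : ℝ) + 1) :=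
    one_div_le_one_div_of_le (by positivity) (by gcongr)
  have hkmono {m n : ℕ} (h : m ≤ n) (p : ℝ≥0 × ℝ≥0) : k m p ≤ k n p :=
    integral_mono (hki m p) (hki n p) fun ω => regRiesz_anti hβ (hε n) (hεa h) _
  have hkc (n : ℕ) : Continuous (k n) := hcont _ (hε n)
  have hkint (n : ℕ) (ρ : Measure (ℝ≥0 × ℝ≥0)) [IsProbabilityMeasure ρ] :
      Integrable (k n) ρ :=
    Integrable.of_bound (hkc n).aestronglyMeasurable _ (.of_forall fun p => by
      rw [Real.norm_eq_abs, abs_of_nonneg (hk0 n p)]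
      exact mean_regRiesz_le hβ (hε n) _)
  -- The kernels increase with the index, so for `n ≥ m` the `k m`-energy of `ν n` is at most its `k
  -- n`-energy. For fixed `m` the kernel is bounded and continuous, so weak convergence applies;
  -- afterwards `m` tends to infinity by monotone convergence.
  have hbound (m : ℕ) : ∫ p, k m p ∂((μ : Measure ℝ≥0).prod (μ : Measure ℝ≥0)) ≤ C := by
    let f : BoundedContinuousFunction (ℝ≥0 × ℝ≥0) ℝ :=
      BoundedContinuousFunction.ofNormedAddCommGroup (k m) (hkc m) _ fun p => by
        rw [Real.norm_eq_abs, abs_of_nonneg (hk0 m p)]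
        exact mean_regRiesz_le hβ (hε m) _
    have h1 : Tendsto (fun n => (ν n).prod (ν n)) L (𝓝 (μ.prod μ)) :=
      ((ProbabilityMeasure.continuous_prod (α := ℝ≥0) (β := ℝ≥0)).tendsto (μ, μ)).comp
        (hlim.prodMk_nhds hlim)
    have h2 := ProbabilityMeasure.tendsto_iff_forall_integral_tendsto.1 h1 f
    refine le_of_tendsto h2 ?_
    filter_upwards [hL (eventually_ge_atTop m)] with n hn
    refine le_trans ?_ (hC n)
    change ∫ p, k m p ∂((ν n : Measure ℝ≥0).prod (ν n : Measure ℝ≥0)) ≤ _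
    refine (integral_mono (hkint m _) (hkint n _) fun p => hkmono hn p).trans (le_of_eq ?_)
    exact integral_prod _ (hkint n _)
  have hsup (y : V) : ‖y‖ₑ ^ (-β) =
      ⨆ n : ℕ, ENNReal.ofReal (regRiesz β (1 / ((n : ℝ) + 1)) y) := by
    refine tendsto_nhds_unique (tendsto_ofReal_regRiesz β y) (tendsto_atTop_iSup ?_)
    exact fun m n h => ENNReal.ofReal_le_ofReal (regRiesz_anti hβ (hε n) (hεa h) y)
  have hinner (p : ℝ≥0 × ℝ≥0) : ∫⁻ ω, ‖X p.1 ω - X p.2 ω‖ₑ ^ (-β) ∂P =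
      ⨆ n, ENNReal.ofReal (k n p) := by
    simp_rw [hsup]
    rw [lintegral_iSup (fun n => (hkm n p).ennreal_ofReal) fun m n h ω =>
      ENNReal.ofReal_le_ofReal (regRiesz_anti hβ (hε n) (hεa h) _)]
    refine iSup_congr fun n => ?_
    exact (ofReal_integral_eq_lintegral_ofReal (hki n p)
      (.of_forall fun ω => regRiesz_nonneg β (hε n) _)).symm
  simp_rw [hinner]
  rw [lintegral_iSup (fun n => (hkc n).measurable.ennreal_ofReal) fun m n h p =>
    ENNReal.ofReal_le_ofReal (hkmono h p)]
  refine iSup_le fun n => ?_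
  rw [← ofReal_integral_eq_lintegral_ofReal (hkint n _) (.of_forall fun p => hk0 n p)]
  exact ENNReal.ofReal_le_ofReal (hbound n)

/-- **From random to deterministic measures.** If with positive probability the image of `G` under
a right-continuous process with independent increments carries a probability measure of finite
energy, then `G` carries a probability measure whose image has finite mean energy. -/
theorem exists_mean_energy_ne_top (hX : ∀ t, Measurable (X t))
    (hrc : ∀ ω t, ContinuousWithinAt (fun s => X s ω) (Ici t) t)
    (hind : HasIndepIncrements X P) {β : ℝ} (hβ : 0 < β)
    (hcont : ∀ ε : ℝ, 0 < ε →
      Continuous fun p : ℝ≥0 × ℝ≥0 => P[fun ω => regRiesz β ε (X p.1 ω - X p.2 ω)])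
    {G : Set ℝ≥0} (hG : MeasurableSet G)
    (hP : P {ω | ∃ θ ∈ probOn ((fun t => X t ω) '' G), fEnergy (fun x => ‖x‖ₑ ^ (-β)) θ ≠ ∞} ≠ 0) :
    ∃ μ : Measure ℝ≥0, IsProbabilityMeasure μ ∧ μ Gᶜ = 0 ∧
      ∫⁻ p, ∫⁻ ω, ‖X p.1 ω - X p.2 ω‖ₑ ^ (-β) ∂P ∂(μ.prod μ) ≠ ∞ := by
  have himage (ω : Ω) (S : ℕ → Set ℝ≥0) :
      (fun t => X t ω) '' (⋃ n, S n) = ⋃ n, (fun t => X t ω) '' S n := image_iUnion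
  have hGU : G = ⋃ N : ℕ, G ∩ Iic (N : ℝ≥0) := by
    rw [← inter_iUnion]
    symm
    refine inter_eq_left.2 fun t _ => mem_iUnion.2 ?_
    obtain ⟨N, hN⟩ := exists_nat_ge t
    exact ⟨N, hN⟩
  have hGm : Monotone fun N : ℕ => G ∩ Iic (N : ℝ≥0) := fun a b h =>
    inter_subset_inter_right _ (Iic_subset_Iic.2 (by exact_mod_cast h))
  obtain ⟨M, N, hMN⟩ : ∃ M N : ℕ,
      P {ω | CarriesEnergy β M ((fun t => X t ω) '' (G ∩ Iic (N : ℝ≥0)))} ≠ 0 := by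
    by_contra! h
    refine hP (measure_mono_null ?_ (measure_iUnion_null fun M => measure_iUnion_null (h M)))
    rintro ω ⟨θ, ⟨hθ, hθG⟩, hθE⟩
    obtain ⟨M, hM⟩ := exists_nat_ge (fEnergy (fun x : V => ‖x‖ₑ ^ (-β)) θ).toReal
    have hθM : fEnergy (fun x : V => ‖x‖ₑ ^ (-β)) θ ≤ ENNReal.ofReal M := by
      rw [← ENNReal.ofReal_toReal hθE]
      exact ENNReal.ofReal_le_ofReal hM
    have h1 : θ ((fun t => X t ω) '' G) = 1 := by
      refine le_antisymm prob_le_one ?_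
      calc (1 : ℝ≥0∞) = θ univ := measure_univ.symm
        _ ≤ θ ((fun t => X t ω) '' G) + θ ((fun t => X t ω) '' G)ᶜ := measure_univ_le_add_compl _
        _ = _ := by rw [hθG, add_zero]
    have h2 : CarriesEnergy β M (⋃ N : ℕ, (fun t => X t ω) '' (G ∩ Iic (N : ℝ≥0))) := by
      refine ⟨θ, prob_le_one, ?_, hθM⟩
      rw [← himage, ← hGU, h1]
      exact ENNReal.half_lt_self one_ne_zero ENNReal.one_ne_top |>.trans_eq' (by simp)
    obtain ⟨N, hN⟩ := (carriesEnergy_iUnion fun a b h => image_mono (hGm h)).1 h2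
    exact mem_iUnion.2 ⟨M, mem_iUnion.2 ⟨N, hN⟩⟩
  -- These events need not be measurable; the outer measure of `P` is still continuous along
  -- increasing unions, which is all that capacitability asks for.
  let Φ : Set ℝ≥0 → ℝ≥0∞ := fun A => P {ω | CarriesEnergy β M ((fun t => X t ω) '' A)}
  have hup (S : ℕ → Set ℝ≥0) (hS : Monotone S) : Φ (⋃ n, S n) = ⨆ n, Φ (S n) := by
    simp only [Φ]
    rw [← Monotone.measure_iUnion]
    · congr 1
      ext ω
      simp only [mem_ofPred_eq, mem_iUnion, himage]
      exact carriesEnergy_iUnion fun a b h => image_mono (hS h)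
    · exact fun a b h ω hω => CarriesEnergy.mono hω (image_mono (hS h)) le_rfl
  have hA := (hG.inter (measurableSet_Iic (a := (N : ℝ≥0)))).analyticSet
  rw [AnalyticSet] at hA
  obtain hA | ⟨f, hf, hfr⟩ := hA
  · refine absurd ?_ hMN
    rw [hA]
    simp [CarriesEnergy]
  obtain ⟨c, hc, hcΦ⟩ : ∃ c : ℝ, 0 < c ∧ ENNReal.ofReal c < Φ (range f) := by
    rw [hfr]
    obtain ⟨r, h1, h2⟩ := ENNReal.lt_iff_exists_nnreal_btwn.1 (pos_iff_ne_zero.2 hMN)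
    exact ⟨r, by exact_mod_cast h1, by rwa [ENNReal.ofReal_coe_nnreal]⟩
  obtain ⟨A, hAanti, hAr, hAc, hAlim⟩ := exists_antitone_subsets_of_lt hf hup hcΦ
  have hε (n : ℕ) : 0 < 1 / ((n : ℝ) + 1) := by positivity
  have hAN (n : ℕ) : A n ⊆ Iic (N : ℝ≥0) := (hAr n).trans (hfr ▸ inter_subset_right)
  have hex (n : ℕ) := exists_probabilityMeasure_energy_le hX hrc hind hβ (hε n)
    (Nat.cast_nonneg M) (hAN n) hc (hAc n) (hε n)
  choose ν hν hνE using hex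
  -- The infimum defining the distance to `A n` need not be attained; doubling the radius provides
  -- an actual nearby point.
  have hthick (n : ℕ) (t : ℝ≥0) (ht : t ∈ Metric.cthickening (1 / ((n : ℝ) + 1)) (A n)) :
      ∃ s ∈ A n, dist s t ≤ 2 * (1 / ((n : ℝ) + 1)) := by
    have := Metric.cthickening_subset_thickening' (δ₂ := 2 * (1 / ((n : ℝ) + 1)))
      (by positivity) (by linarith [hε n]) _ ht
    obtain ⟨s, hs, hst⟩ := Metric.mem_thickening_iff.1 this
    exact ⟨s, hs, by rw [dist_comm]; exact hst.le⟩
  have hνc (n : ℕ) : (ν n : Measure ℝ≥0) (Metric.cthickening (1 / ((n : ℝ) + 1)) (A n))ᶜ = 0 :=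
    (prob_compl_eq_zero_iff Metric.isClosed_cthickening.measurableSet).2 (hν n)
  obtain ⟨L, μ, hLne, hL, hlim⟩ := exists_tendsto_of_forall_compl_eq_zero ν
    (isCompact_Icc (a := (0 : ℝ≥0)) (b := N + 2)) fun n => by
      refine measure_mono_null (compl_subset_compl.2 fun t ht => ⟨zero_le, ?_⟩) (hνc n)
      obtain ⟨s, hs, hst⟩ := hthick n t ht
      have h1 : (s : ℝ) ≤ N := by exact_mod_cast hAN n hs
      have h2 : 1 / ((n : ℝ) + 1) ≤ 1 := by
        rw [div_le_one (by positivity)]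
        linarith [(Nat.cast_nonneg n : (0 : ℝ) ≤ n)]
      rw [NNReal.dist_eq] at hst
      have h3 := (abs_le.1 hst).1
      rw [← NNReal.coe_le_coe]
      push_cast
      linarith
  refine ⟨μ, inferInstance, ?_, ne_top_of_le_ne_top ENNReal.ofReal_ne_top
    (lintegral_enorm_rpow_le_of_tendsto hX hβ hcont hL hlim hνE)⟩
  -- For `m ≥ n` the measure `ν m` is carried by the `n`-th closed thickening, since both the radii
  -- and the sets `A m` decrease. Weak limits keep full mass on closed sets.
  have hclosed (n : ℕ) :
      (μ : Measure ℝ≥0) (Metric.cthickening (1 / ((n : ℝ) + 1)) (A n))ᶜ = 0 := by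
    rw [prob_compl_eq_zero_iff Metric.isClosed_cthickening.measurableSet]
    refine le_antisymm prob_le_one ?_
    refine le_trans ?_ (ProbabilityMeasure.limsup_measure_closed_le_of_tendsto hlim
      Metric.isClosed_cthickening)
    refine le_limsup_of_frequently_le (Eventually.frequently ?_)
    filter_upwards [hL (eventually_ge_atTop n)] with m hm
    rw [← hν m]
    refine measure_mono ((Metric.cthickening_mono ?_ _).trans
      (Metric.cthickening_subset_of_subset _ (hAanti hm)))
    exact one_div_le_one_div_of_le (by positivity) (by gcongr)
  refine measure_mono_null (fun t ht => ?_) (measure_iUnion_null hclosed)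
  by_contra h
  simp only [mem_iUnion, mem_compl_iff, not_exists, not_not] at h
  refine ht ?_
  have h2 : Tendsto (fun n : ℕ => 2 * (1 / ((n : ℝ) + 1))) atTop (𝓝 0) := by
    simpa using tendsto_one_div_add_atTop_nhds_zero_nat.const_mul (2 : ℝ)
  have := mem_of_forall_dist_le hAlim h2 fun n => hthick n t (h n)
  rw [hfr] at this
  exact this.1

end Limit

/-! ### The characters `χ_ξ` and increments of Lévy processes -/

section Chi

variable {d : ℕ} {Ψ : EuclideanSpace ℝ (Fin d) → ℂ} {ξ : EuclideanSpace ℝ (Fin d)}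

lemma levyChi_of_nonneg {x : ℝ} (hx : 0 ≤ x) : levyChi Ψ ξ x = Complex.exp (-(x : ℂ) * Ψ ξ) := by
  rcases hx.eq_or_lt with rfl | hx
  · simp [levyChi]
  · simp [levyChi, Real.sign_of_pos hx, abs_of_pos hx]

lemma levyChi_of_nonpos {x : ℝ} (hx : x ≤ 0) :
    levyChi Ψ ξ x = Complex.exp ((x : ℂ) * Ψ (-ξ)) := by
  rcases hx.eq_or_lt with rfl | hx
  · simp [levyChi]
  · simp [levyChi, Real.sign_of_neg hx, abs_of_neg hx]

lemma continuous_levyChi (Ψ : EuclideanSpace ℝ (Fin d) → ℂ) (ξ : EuclideanSpace ℝ (Fin d)) :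
    Continuous (levyChi Ψ ξ) := by
  have : levyChi Ψ ξ = fun x : ℝ => if 0 ≤ x then Complex.exp (-(x : ℂ) * Ψ ξ) else
      Complex.exp ((x : ℂ) * Ψ (-ξ)) := by
    ext x
    split_ifs with h
    · exact levyChi_of_nonneg h
    · exact levyChi_of_nonpos (not_le.1 h).le
  rw [this]
  refine Continuous.if_le (by fun_prop) (by fun_prop) continuous_const continuous_id ?_
  rintro x rfl
  simp

lemma measurable_reChiPos_apply (Ψ : EuclideanSpace ℝ (Fin d) → ℂ)
    (ξ : EuclideanSpace ℝ (Fin d)) : Measurable (reChiPos Ψ ξ) :=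
  ((Complex.measurable_re.comp (continuous_levyChi Ψ ξ).measurable).max
    measurable_const).ennreal_ofReal

lemma measurable_reChiNeg_apply (Ψ : EuclideanSpace ℝ (Fin d) → ℂ)
    (ξ : EuclideanSpace ℝ (Fin d)) : Measurable (reChiNeg Ψ ξ) :=
  ((Complex.measurable_re.comp (continuous_levyChi Ψ ξ).measurable).neg.max
    measurable_const).ennreal_ofReal

end Chi

/-- A process with right-continuous paths and the increments of a Lévy process with
exponent `Ψ`. -/
structure IsRegularLevy {d : ℕ} {Ω : Type*} [MeasurableSpace Ω]
    (X : ℝ≥0 → Ω → EuclideanSpace ℝ (Fin d)) (Ψ : EuclideanSpace ℝ (Fin d) → ℂ)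
    (P : Measure Ω) : Prop where
  measurable : ∀ t, Measurable (X t)
  right_continuous : ∀ ω t, ContinuousWithinAt (fun s => X s ω) (Ici t) t
  indep_increments : HasIndepIncrements X P
  charFun_sub : ∀ (s t : ℝ≥0) ξ,
    charFun (P.map fun ω => X s ω - X t ω) ξ = levyChi Ψ ξ ((s : ℝ) - t)

section Levy

variable {d : ℕ} {Ω : Type*} [MeasurableSpace Ω] {P : Measure Ω} [IsProbabilityMeasure P]
  {X : ℝ≥0 → Ω → EuclideanSpace ℝ (Fin d)} {Ψ : EuclideanSpace ℝ (Fin d) → ℂ}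

-- For `s ≥ t` this is stationarity of increments. For `s < t` the increment is reflected, which
-- replaces `ξ` by `-ξ`; this is the role of the sign in `levyChi`.
omit [IsProbabilityMeasure P] in
lemma IsLevyProcess.charFun_sub (hX : IsLevyProcess X P) (hΨ : IsLevyExponent Ψ X P)
    (s t : ℝ≥0) (ξ : EuclideanSpace ℝ (Fin d)) :
    charFun (P.map fun ω => X s ω - X t ω) ξ = levyChi Ψ ξ ((s : ℝ) - t) := by
  have key (s r : ℝ≥0) (ξ : EuclideanSpace ℝ (Fin d)) :
      charFun (P.map fun ω => X (s + r) ω - X s ω) ξ = Complex.exp (-((r : ℝ) : ℂ) * Ψ ξ) := by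
    rw [(hX.stationary_increments s r).map_eq, hΨ]
  rcases le_total t s with h | h
  · obtain ⟨r, rfl⟩ := exists_add_of_le h
    rw [key, levyChi_of_nonneg (by push_cast; linarith [r.2])]
    push_cast; ring_nf
  · obtain ⟨r, rfl⟩ := exists_add_of_le h
    have e : (fun ω => X s ω - X (s + r) ω) = fun ω => (-1 : ℝ) • (X (s + r) ω - X s ω) := by
      ext1 ω; simp
    have hm : Measurable fun ω => X (s + r) ω - X s ω := (hX.measurable _).sub (hX.measurable _)
    have e2 : P.map (fun ω => (-1 : ℝ) • (X (s + r) ω - X s ω)) =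
        (P.map fun ω => X (s + r) ω - X s ω).map ((-1 : ℝ) • ·) :=
      (Measure.map_map (by fun_prop) hm).symm
    rw [e, e2, charFun_map_smul, key, levyChi_of_nonpos (by push_cast; linarith [r.2])]
    push_cast; simp

omit [IsProbabilityMeasure P] in
/-- Every Lévy process has a version with right-continuous paths. -/
theorem IsLevyProcess.exists_regular (hX : IsLevyProcess X P) (hΨ : IsLevyExponent Ψ X P) :
    ∃ Y : ℝ≥0 → Ω → EuclideanSpace ℝ (Fin d), IsRegularLevy Y Ψ P ∧
      ∀ᵐ ω ∂P, ∀ t, Y t ω = X t ω := by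
  classical
  obtain ⟨S, hS, hSm, hPS⟩ : ∃ S : Set Ω,
      (∀ ω ∈ S, ∀ t, ContinuousWithinAt (fun s => X s ω) (Ici t) t) ∧ MeasurableSet S ∧
        P Sᶜ = 0 := by
    -- The set of right-continuous paths need not be measurable; its complement is enlarged to a
    -- measurable null set, off which the process is left unchanged.
    refine ⟨(toMeasurable P {ω | ∀ t : ℝ≥0, ContinuousWithinAt (fun s => X s ω) (Ici t) t}ᶜ)ᶜ,
      fun ω hω => ?_, (measurableSet_toMeasurable _ _).compl, ?_⟩
    · by_contra hc
      exact hω (subset_toMeasurable _ _ hc)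
    · rw [compl_compl, measure_toMeasurable]
      exact mem_ae_iff.1 (hX.cadlag.mono fun ω hω t => (hω t).1)
  let Y : ℝ≥0 → Ω → EuclideanSpace ℝ (Fin d) := fun t => S.indicator (X t)
  have hY : ∀ᵐ ω ∂P, ∀ t, Y t ω = X t ω := by
    filter_upwards [mem_ae_iff.2 hPS] with ω hω t
    exact indicator_of_mem hω _
  refine ⟨Y, ⟨fun t => (hX.measurable t).indicator hSm, fun ω t => ?_, fun n t ht => ?_,
    fun s t ξ => ?_⟩, hY⟩
  · by_cases hω : ω ∈ S
    · simpa only [Y, indicator_of_mem hω] using hS ω hω t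
    · simpa only [Y, indicator_of_notMem hω] using continuousWithinAt_const
  · refine (hX.indep_increments n t ht).congr fun i => ?_
    filter_upwards [hY] with ω hω
    rw [hω, hω]
  · rw [← hX.charFun_sub hΨ s t ξ]
    congr 1
    refine Measure.map_congr ?_
    filter_upwards [hY] with ω hω
    rw [hω, hω]

namespace IsRegularLevy

-- By right-continuity the process is the pointwise limit of its values at times rounded up to a
-- grid, and these are jointly measurable because a grid is countable.
omit [IsProbabilityMeasure P] in
lemma measurable_uncurry (h : IsRegularLevy X Ψ P) : Measurable fun p : ℝ≥0 × Ω => X p.1 p.2 := by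
  refine measurable_of_tendsto_metrizable (f := fun (m : ℕ) (p : ℝ≥0 × Ω) =>
    X (gridTime m ⌈(m + 1) * p.1⌉₊) p.2) (fun m => ?_) ?_
  · have h1 : Measurable fun q : ℕ × Ω => X (gridTime m q.1) q.2 :=
      measurable_from_prod_countable_right fun i => h.measurable (gridTime m i)
    have h2 : Measurable fun p : ℝ≥0 × Ω => (⌈((m : ℝ≥0) + 1) * p.1⌉₊, p.2) := by fun_prop
    exact h1.comp h2
  · rw [tendsto_pi_nhds]
    exact fun p => (h.right_continuous p.2 p.1).tendsto.comp (tendsto_gridTime_ceil p.1)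

omit [IsProbabilityMeasure P] in
lemma measurable_sub (h : IsRegularLevy X Ψ P) :
    Measurable fun q : (ℝ≥0 × ℝ≥0) × Ω => X q.1.1 q.2 - X q.1.2 q.2 :=
  (h.measurable_uncurry.comp ((measurable_fst.comp measurable_fst).prodMk measurable_snd)).sub
    (h.measurable_uncurry.comp ((measurable_snd.comp measurable_fst).prodMk measurable_snd))

/-- No measurability of `Ψ` is assumed. The function is continuous in the time variable, and at a
fixed time `x = x⁺ - x⁻` it is the characteristic function of the increment between `x⁻` and `x⁺`.
-/
lemma measurable_levyChi (h : IsRegularLevy X Ψ P) :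
    Measurable fun q : EuclideanSpace ℝ (Fin d) × ℝ => levyChi Ψ q.1 q.2 := by
  have h1 : Measurable (Function.uncurry fun (x : ℝ) ξ => levyChi Ψ ξ x) := by
    refine measurable_uncurry_of_continuous_of_measurable (fun ξ => continuous_levyChi Ψ ξ)
      fun x => ?_
    have e : (fun ξ => levyChi Ψ ξ x) = charFun (P.map fun ω => X x.toNNReal ω -
        X (-x).toNNReal ω) := by
      ext ξ
      rw [h.charFun_sub]
      congr 1
      rcases le_total 0 x with hx | hx
      · simp [hx]
      · simp [hx]
    rw [e]
    exact measurable_charFun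
  exact h1.comp measurable_swap

lemma norm_levyChi_le (h : IsRegularLevy X Ψ P) (ξ : EuclideanSpace ℝ (Fin d)) (s t : ℝ≥0) :
    ‖levyChi Ψ ξ ((s : ℝ) - t)‖ ≤ 1 := by
  have : IsProbabilityMeasure (P.map fun ω => X s ω - X t ω) :=
    Measure.isProbabilityMeasure_map ((h.measurable s).sub (h.measurable t)).aemeasurable
  rw [← h.charFun_sub]
  exact norm_charFun_le_one ξ

/-- The law of an increment depends continuously on the two times. -/
lemma continuous_mean_regRiesz (h : IsRegularLevy X Ψ P) {β ε : ℝ} (hβ : 0 < β) (hε : 0 < ε) :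
    Continuous fun p : ℝ≥0 × ℝ≥0 => P[fun ω => regRiesz β ε (X p.1 ω - X p.2 ω)] := by
  have hm (p : ℝ≥0 × ℝ≥0) : Measurable fun ω => X p.1 ω - X p.2 ω :=
    (h.measurable _).sub (h.measurable _)
  let ρ : ℝ≥0 × ℝ≥0 → ProbabilityMeasure (EuclideanSpace ℝ (Fin d)) := fun p =>
    ⟨P.map fun ω => X p.1 ω - X p.2 ω, Measure.isProbabilityMeasure_map (hm p).aemeasurable⟩
  let f : BoundedContinuousFunction (EuclideanSpace ℝ (Fin d)) ℝ :=
    BoundedContinuousFunction.ofNormedAddCommGroup (regRiesz β ε) (continuous_regRiesz β hε) _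
      fun x => by
        rw [Real.norm_eq_abs, abs_of_nonneg (regRiesz_nonneg β hε x)]
        exact regRiesz_le hβ hε x
  have e (p : ℝ≥0 × ℝ≥0) : P[fun ω => regRiesz β ε (X p.1 ω - X p.2 ω)] =
      ∫ x, f x ∂(ρ p : Measure (EuclideanSpace ℝ (Fin d))) :=
    (integral_map (hm p).aemeasurable (continuous_regRiesz β hε).aestronglyMeasurable).symm
  simp_rw [e]
  refine continuous_iff_seqContinuous.2 fun p q hp => ?_
  refine ProbabilityMeasure.tendsto_iff_forall_integral_tendsto.1 ?_ f
  refine ProbabilityMeasure.tendsto_iff_tendsto_charFun.2 fun ξ => ?_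
  have e2 (p : ℝ≥0 × ℝ≥0) : charFun (ρ p : Measure (EuclideanSpace ℝ (Fin d))) ξ =
      levyChi Ψ ξ ((p.1 : ℝ) - p.2) := h.charFun_sub _ _ _
  simp_rw [e2]
  have hc : Continuous fun p : ℝ≥0 × ℝ≥0 => levyChi Ψ ξ ((p.1 : ℝ) - p.2) :=
    (continuous_levyChi Ψ ξ).comp (by fun_prop)
  exact (hc.tendsto q).comp hp

end IsRegularLevy

/-- The law of the increment of `X` between two independent times with law `μ`. -/
noncomputable def meanIncrementLaw (X : ℝ≥0 → Ω → EuclideanSpace ℝ (Fin d)) (P : Measure Ω)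
    (μ : Measure ℝ≥0) : Measure (EuclideanSpace ℝ (Fin d)) :=
  ((μ.prod μ).prod P).map fun q => X q.1.1 q.2 - X q.1.2 q.2

instance (X : ℝ≥0 → Ω → EuclideanSpace ℝ (Fin d)) (μ : Measure ℝ≥0) [IsProbabilityMeasure μ] :
    IsFiniteMeasure (meanIncrementLaw X P μ) := by
  unfold meanIncrementLaw; infer_instance

namespace IsRegularLevy

variable {μ : Measure ℝ≥0} [IsProbabilityMeasure μ]

omit [IsProbabilityMeasure μ] in
lemma lintegral_meanIncrementLaw (h : IsRegularLevy X Ψ P) {f : EuclideanSpace ℝ (Fin d) → ℝ≥0∞}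
    (hf : Measurable f) : ∫⁻ x, f x ∂(meanIncrementLaw X P μ) =
      ∫⁻ p, ∫⁻ ω, f (X p.1 ω - X p.2 ω) ∂P ∂(μ.prod μ) := by
  rw [meanIncrementLaw, lintegral_map hf h.measurable_sub]
  exact lintegral_prod _ (hf.comp h.measurable_sub).aemeasurable

lemma charFun_meanIncrementLaw (h : IsRegularLevy X Ψ P) (ξ : EuclideanSpace ℝ (Fin d)) :
    charFun (meanIncrementLaw X P μ) ξ =
      ∫ p, levyChi Ψ ξ ((p.1 : ℝ) - p.2) ∂(μ.prod μ) := by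
  rw [charFun_apply, meanIncrementLaw, integral_map h.measurable_sub.aemeasurable
    (Continuous.aestronglyMeasurable (by fun_prop)), integral_prod]
  · refine integral_congr_ae (.of_forall fun p => ?_)
    simp only
    have hp : Measurable fun ω => X p.1 ω - X p.2 ω := (h.measurable _).sub (h.measurable _)
    rw [← h.charFun_sub, charFun_apply, integral_map hp.aemeasurable
      (Continuous.aestronglyMeasurable (by fun_prop))]
  · refine Integrable.of_bound (Measurable.aestronglyMeasurable ?_) 1 (.of_forall fun q => by
      rw [Complex.norm_exp_ofReal_mul_I])
    exact (Continuous.measurable (by fun_prop : Continuous fun x : EuclideanSpace ℝ (Fin d) =>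
      Complex.exp ((inner ℝ x ξ : ℝ) * Complex.I))).comp h.measurable_sub

/-- The mean energy of a character is the mean square of a Fourier transform. -/
lemma re_charFun_meanIncrementLaw_nonneg (h : IsRegularLevy X Ψ P)
    (ξ : EuclideanSpace ℝ (Fin d)) : 0 ≤ (charFun (meanIncrementLaw X P μ) ξ).re := by
  rw [re_charFun_eq_integral_cos, meanIncrementLaw, integral_map h.measurable_sub.aemeasurable
    (Continuous.aestronglyMeasurable (by fun_prop)), integral_prod_symm]
  · refine integral_nonneg fun ω => ?_
    have hmω : Measurable fun s => X s ω := h.measurable_uncurry.comp measurable_prodMk_right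
    have hi1 : Integrable (fun s => Real.cos (inner ℝ (X s ω) ξ)) μ :=
      Integrable.of_bound (Measurable.aestronglyMeasurable (by fun_prop)) 1
        (.of_forall fun s => Real.abs_cos_le_one _)
    have hi2 : Integrable (fun s => Real.sin (inner ℝ (X s ω) ξ)) μ :=
      Integrable.of_bound (Measurable.aestronglyMeasurable (by fun_prop)) 1
        (.of_forall fun s => Real.abs_sin_le_one _)
    have e : ∫ p : ℝ≥0 × ℝ≥0, Real.cos (inner ℝ (X p.1 ω - X p.2 ω) ξ) ∂(μ.prod μ) =
        (∫ s, Real.cos (inner ℝ (X s ω) ξ) ∂μ) ^ 2 + (∫ s, Real.sin (inner ℝ (X s ω) ξ) ∂μ) ^ 2 := by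
      simp_rw [inner_sub_left, Real.cos_sub]
      rw [integral_add (hi1.mul_prod hi1) (hi2.mul_prod hi2),
        integral_prod_mul (fun s => Real.cos (inner ℝ (X s ω) ξ)) fun s =>
          Real.cos (inner ℝ (X s ω) ξ),
        integral_prod_mul (fun s => Real.sin (inner ℝ (X s ω) ξ)) fun s =>
          Real.sin (inner ℝ (X s ω) ξ), sq, sq]
    simp only [Pi.zero_apply]
    rw [e]
    positivity
  · refine Integrable.of_bound (Measurable.aestronglyMeasurable ?_) 1 (.of_forall fun q =>
      Real.abs_cos_le_one _)
    exact (Continuous.measurable (by fun_prop : Continuous fun x : EuclideanSpace ℝ (Fin d) =>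
      Real.cos (inner ℝ x ξ))).comp h.measurable_sub

end IsRegularLevy

end Levy

/-! ### Energies of the positive and negative parts of the characters -/

section Energies

/-- The identity `u⁺ = u + u⁻` avoids subtraction in `[0, ∞]`; the sign of the integral ensures that
`ENNReal.ofReal` does not truncate it. -/
lemma lintegral_ofReal_pos_part {α : Type*} [MeasurableSpace α] {μ : Measure α} {u : α → ℝ}
    (hu : Integrable u μ) (h0 : 0 ≤ ∫ x, u x ∂μ) :
    ∫⁻ x, ENNReal.ofReal (max (u x) 0) ∂μ =
      ENNReal.ofReal (∫ x, u x ∂μ) + ∫⁻ x, ENNReal.ofReal (max (-u x) 0) ∂μ := by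
  have hp : Integrable (fun x => max (u x) 0) μ := hu.pos_part
  have hn : Integrable (fun x => max (-u x) 0) μ := hu.neg_part
  have hn0 : 0 ≤ ∫ x, max (-u x) 0 ∂μ := integral_nonneg fun x => le_max_right _ _
  rw [← ofReal_integral_eq_lintegral_ofReal hp (.of_forall fun x => le_max_right _ _),
    ← ofReal_integral_eq_lintegral_ofReal hn (.of_forall fun x => le_max_right _ _),
    ← ENNReal.ofReal_add h0 hn0, ← integral_add hu hn]
  congr 1
  refine integral_congr_ae (.of_forall fun x => ?_)
  simp only
  rcases le_total 0 (u x) with h | h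
  · rw [max_eq_left h, max_eq_right (by linarith)]; ring
  · rw [max_eq_right h, max_eq_left (by linarith)]; ring

lemma fEnergy_map_coe {f : ℝ → ℝ≥0∞} (hf : Measurable f) (μ : Measure ℝ≥0) [SFinite μ] :
    fEnergy f (μ.map ((↑) : ℝ≥0 → ℝ)) = ∫⁻ p, f ((p.1 : ℝ) - p.2) ∂(μ.prod μ) := by
  have hc : Measurable ((↑) : ℝ≥0 → ℝ) := measurable_coe_nnreal_real
  have h1 : Measurable fun q : ℝ × ℝ => f (q.1 - q.2) := by fun_prop
  rw [fEnergy, lintegral_map h1.lintegral_prod_right' hc, lintegral_prod _ (by fun_prop)]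
  exact lintegral_congr fun s => lintegral_map (by fun_prop) hc

lemma exists_eq_map_coe {G : Set ℝ} (hG : MeasurableSet G) (hG0 : G ⊆ Ici 0) {ν : Measure ℝ}
    (hν : ν ∈ probOn G) :
    ∃ μ : Measure ℝ≥0, IsProbabilityMeasure μ ∧ μ (((↑) : ℝ≥0 → ℝ) ⁻¹' G)ᶜ = 0 ∧
      ν = μ.map ((↑) : ℝ≥0 → ℝ) := by
  obtain ⟨hν1, hν0⟩ := hν
  have hae : ∀ᵐ x ∂ν, x ∈ G := mem_ae_iff.2 hν0
  have e : ν = (ν.map Real.toNNReal).map ((↑) : ℝ≥0 → ℝ) := by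
    rw [Measure.map_map measurable_coe_nnreal_real measurable_real_toNNReal]
    conv_lhs => rw [← Measure.map_id (μ := ν)]
    refine Measure.map_congr ?_
    filter_upwards [hae] with x hx
    simp [Real.coe_toNNReal x (hG0 hx)]
  refine ⟨ν.map Real.toNNReal,
    Measure.isProbabilityMeasure_map measurable_real_toNNReal.aemeasurable, ?_, e⟩
  rw [← preimage_compl, ← Measure.map_apply measurable_coe_nnreal_real hG.compl, ← e, hν0]

lemma map_coe_mem_probOn {G : Set ℝ} (hG : MeasurableSet G) {μ : Measure ℝ≥0}
    [IsProbabilityMeasure μ] (hμ : μ (((↑) : ℝ≥0 → ℝ) ⁻¹' G)ᶜ = 0) :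
    μ.map ((↑) : ℝ≥0 → ℝ) ∈ probOn G :=
  ⟨Measure.isProbabilityMeasure_map measurable_coe_nnreal_real.aemeasurable, by
    rwa [Measure.map_apply measurable_coe_nnreal_real hG.compl]⟩

lemma fCapacity_pos_iff {E : Type*} [MeasurableSpace E] [Sub E] {f : E → ℝ≥0∞} {A : Set E} :
    0 < fCapacity f A ↔ ∃ μ ∈ probOn A, fEnergy f μ ≠ ∞ := by
  rw [fCapacity, ENNReal.inv_pos, ← lt_top_iff_ne_top]
  simp only [iInf_lt_iff, exists_prop, ← lt_top_iff_ne_top]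

variable {d : ℕ} {Ω : Type*} [MeasurableSpace Ω] {P : Measure Ω} [IsProbabilityMeasure P]
  {X : ℝ≥0 → Ω → EuclideanSpace ℝ (Fin d)} {Ψ : EuclideanSpace ℝ (Fin d) → ℂ}

namespace IsRegularLevy

lemma measurable_reChiPos (h : IsRegularLevy X Ψ P) :
    Measurable fun q : EuclideanSpace ℝ (Fin d) × ℝ => reChiPos Ψ q.1 q.2 :=
  ((Complex.measurable_re.comp h.measurable_levyChi).max measurable_const).ennreal_ofReal

lemma measurable_reChiNeg (h : IsRegularLevy X Ψ P) :
    Measurable fun q : EuclideanSpace ℝ (Fin d) × ℝ => reChiNeg Ψ q.1 q.2 :=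
  ((Complex.measurable_re.comp h.measurable_levyChi).neg.max measurable_const).ennreal_ofReal

/-- Tonelli's theorem for the energy of a gauge that is a mixture. -/
lemma fEnergy_mixture {f : EuclideanSpace ℝ (Fin d) → ℝ → ℝ≥0∞}
    (hf : Measurable fun q : EuclideanSpace ℝ (Fin d) × ℝ => f q.1 q.2) (γ : ℝ)
    (μ : Measure ℝ≥0) [IsProbabilityMeasure μ] :
    fEnergy (fun x => ∫⁻ ξ : EuclideanSpace ℝ (Fin d), f ξ x * ‖ξ‖ₑ ^ (-γ))
      (μ.map ((↑) : ℝ≥0 → ℝ)) =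
    ∫⁻ ξ : EuclideanSpace ℝ (Fin d),
      fEnergy (f ξ) (μ.map ((↑) : ℝ≥0 → ℝ)) * ‖ξ‖ₑ ^ (-γ) := by
  have hf1 (ξ : EuclideanSpace ℝ (Fin d)) : Measurable (f ξ) := hf.comp measurable_prodMk_left
  have hw : Measurable fun q : ℝ × EuclideanSpace ℝ (Fin d) => f q.2 q.1 * ‖q.2‖ₑ ^ (-γ) :=
    (hf.comp measurable_swap).mul (by fun_prop)
  rw [fEnergy_map_coe hw.lintegral_prod_right']
  simp_rw [fEnergy_map_coe (hf1 _)]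
  rw [lintegral_lintegral_swap]
  · refine lintegral_congr fun ξ => ?_
    have hfξ : Measurable fun p : ℝ≥0 × ℝ≥0 => f ξ ((p.1 : ℝ) - p.2) :=
      (hf1 ξ).comp (by fun_prop)
    rw [lintegral_mul_const _ hfξ]
  · refine Measurable.aemeasurable ?_
    exact hw.comp (((measurable_coe_nnreal_real.comp (measurable_fst.comp measurable_fst)).sub
      (measurable_coe_nnreal_real.comp (measurable_snd.comp measurable_fst))).prodMk
        measurable_snd)

/-- The energies of the positive and of the negative part of a character differ by the mean square
of a Fourier transform. -/
lemma fEnergy_reChiPos_eq (h : IsRegularLevy X Ψ P) (μ : Measure ℝ≥0) [IsProbabilityMeasure μ]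
    (ξ : EuclideanSpace ℝ (Fin d)) :
    fEnergy (reChiPos Ψ ξ) (μ.map ((↑) : ℝ≥0 → ℝ)) =
      ENNReal.ofReal (charFun (meanIncrementLaw X P μ) ξ).re +
        fEnergy (reChiNeg Ψ ξ) (μ.map ((↑) : ℝ≥0 → ℝ)) := by
  have hχ : Measurable fun p : ℝ≥0 × ℝ≥0 => levyChi Ψ ξ ((p.1 : ℝ) - p.2) :=
    (continuous_levyChi Ψ ξ).measurable.comp (by fun_prop)
  have hi : Integrable (fun p : ℝ≥0 × ℝ≥0 => levyChi Ψ ξ ((p.1 : ℝ) - p.2)) (μ.prod μ) :=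
    Integrable.of_bound hχ.aestronglyMeasurable 1 (.of_forall fun p => h.norm_levyChi_le ξ _ _)
  have hre : Integrable (fun p : ℝ≥0 × ℝ≥0 => (levyChi Ψ ξ ((p.1 : ℝ) - p.2)).re) (μ.prod μ) :=
    hi.re
  have e3 : (charFun (meanIncrementLaw X P μ) ξ).re =
      ∫ p : ℝ≥0 × ℝ≥0, (levyChi Ψ ξ ((p.1 : ℝ) - p.2)).re ∂(μ.prod μ) := by
    rw [h.charFun_meanIncrementLaw]
    exact (integral_re hi).symm
  have hmp : Measurable (reChiPos Ψ ξ) := measurable_reChiPos_apply Ψ ξ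
  have hmn : Measurable (reChiNeg Ψ ξ) := measurable_reChiNeg_apply Ψ ξ
  have hpos := h.re_charFun_meanIncrementLaw_nonneg (μ := μ) ξ
  rw [e3] at hpos ⊢
  rw [fEnergy_map_coe hmp, fEnergy_map_coe hmn]
  exact lintegral_ofReal_pos_part hre hpos

end IsRegularLevy

end Energies

/-! ### Comparison of capacities: parts (a), (c) and (e) -/

section Capacities

variable {d : ℕ} {Ω : Type*} [MeasurableSpace Ω] {P : Measure Ω} [IsProbabilityMeasure P]
  {X : ℝ≥0 → Ω → EuclideanSpace ℝ (Fin d)} {Ψ : EuclideanSpace ℝ (Fin d) → ℂ}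

omit [MeasurableSpace Ω] in
lemma imageSet_eq_image (X : ℝ≥0 → Ω → EuclideanSpace ℝ (Fin d)) (G : Set ℝ) (ω : Ω) :
    imageSet X G ω = (fun t => X t ω) '' (((↑) : ℝ≥0 → ℝ) ⁻¹' G) := rfl

omit [MeasurableSpace Ω] in
lemma imageSet_congr {X Y : ℝ≥0 → Ω → EuclideanSpace ℝ (Fin d)} {ω : Ω}
    (h : ∀ t, Y t ω = X t ω) (G : Set ℝ) : imageSet X G ω = imageSet Y G ω := by
  simp only [imageSet, h]

namespace IsRegularLevy

lemma fEnergy_gaugePos (h : IsRegularLevy X Ψ P) (γ : ℝ) (μ : Measure ℝ≥0)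
    [IsProbabilityMeasure μ] :
    fEnergy (gaugePos Ψ γ) (μ.map ((↑) : ℝ≥0 → ℝ)) = ∫⁻ ξ : EuclideanSpace ℝ (Fin d),
      fEnergy (reChiPos Ψ ξ) (μ.map ((↑) : ℝ≥0 → ℝ)) * ‖ξ‖ₑ ^ (-γ) :=
  fEnergy_mixture h.measurable_reChiPos γ μ

lemma fEnergy_gaugeNeg (h : IsRegularLevy X Ψ P) (γ : ℝ) (μ : Measure ℝ≥0)
    [IsProbabilityMeasure μ] :
    fEnergy (gaugeNeg Ψ γ) (μ.map ((↑) : ℝ≥0 → ℝ)) = ∫⁻ ξ : EuclideanSpace ℝ (Fin d),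
      fEnergy (reChiNeg Ψ ξ) (μ.map ((↑) : ℝ≥0 → ℝ)) * ‖ξ‖ₑ ^ (-γ) :=
  fEnergy_mixture h.measurable_reChiNeg γ μ

/-- The mean Riesz energy of the image of a measure under the process. -/
lemma exists_mean_energy_eq (h : IsRegularLevy X Ψ P) {β : ℝ} (hβ : 0 < β) (hd : β < d) :
    ∃ c : ℝ≥0∞, c ≠ 0 ∧ c ≠ ∞ ∧ ∀ (μ : Measure ℝ≥0) [IsProbabilityMeasure μ],
      ∫⁻ p, ∫⁻ ω, ‖X p.1 ω - X p.2 ω‖ₑ ^ (-β) ∂P ∂(μ.prod μ) =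
        c * ∫⁻ ξ : EuclideanSpace ℝ (Fin d),
          ENNReal.ofReal (charFun (meanIncrementLaw X P μ) ξ).re * ‖ξ‖ₑ ^ (β - d) := by
  obtain ⟨c, hc0, hc, H⟩ := exists_lintegral_enorm_rpow_eq (V := EuclideanSpace ℝ (Fin d)) hβ
    (by simpa using hd)
  refine ⟨c, hc0, hc, fun μ _ => ?_⟩
  have := H (meanIncrementLaw X P μ) h.re_charFun_meanIncrementLaw_nonneg
  rw [h.lintegral_meanIncrementLaw (by fun_prop), finrank_euclideanSpace_fin] at this
  exact this

theorem fCapacity_gaugeNeg_pos (h : IsRegularLevy X Ψ P) {G : Set ℝ} (hG : MeasurableSet G)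
    (hG0 : G ⊆ Ici 0) {γ : ℝ} (hpos : 0 < fCapacity (gaugePos Ψ γ) G) :
    0 < fCapacity (gaugeNeg Ψ γ) G := by
  rw [fCapacity_pos_iff] at hpos ⊢
  obtain ⟨ν, hν, hE⟩ := hpos
  refine ⟨ν, hν, ne_top_of_le_ne_top hE ?_⟩
  obtain ⟨μ, hμ, -, rfl⟩ := exists_eq_map_coe hG hG0 hν
  rw [h.fEnergy_gaugePos, h.fEnergy_gaugeNeg]
  refine lintegral_mono fun ξ => ?_
  rw [h.fEnergy_reChiPos_eq μ ξ]
  gcongr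
  exact le_add_self

/-- A measure of finite `g_+`-energy has an image of finite mean Riesz energy, so by Tonelli almost
every path gives an image measure of finite energy. That measure is carried by `X(G)` because
analytic sets are universally measurable. -/
theorem fCapacity_gaugePos_eq_zero (h : IsRegularLevy X Ψ P) {G : Set ℝ} (hG : MeasurableSet G)
    (hG0 : G ⊆ Ici 0) {β : ℝ} (hβ : 0 < β) (hd : β < d)
    (hcap : ∀ᵐ ω ∂P, rieszCapacity β (imageSet X G ω) = 0) :
    fCapacity (gaugePos Ψ (d - β)) G = 0 := by
  by_contra hne
  obtain ⟨ν, hν, hE⟩ := fCapacity_pos_iff.1 (pos_iff_ne_zero.2 hne)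
  obtain ⟨μ, hμ, hμG, rfl⟩ := exists_eq_map_coe hG hG0 hν
  obtain ⟨c, -, hc, H⟩ := h.exists_mean_energy_eq hβ hd
  have hfin : ∫⁻ p, ∫⁻ ω, ‖X p.1 ω - X p.2 ω‖ₑ ^ (-β) ∂P ∂(μ.prod μ) ≠ ∞ := by
    rw [H μ]
    refine ENNReal.mul_ne_top hc (ne_top_of_le_ne_top hE ?_)
    rw [h.fEnergy_gaugePos, neg_sub]
    refine lintegral_mono fun ξ => ?_
    rw [h.fEnergy_reChiPos_eq μ ξ]
    gcongr
    exact le_self_add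
  have hf : Measurable fun x : EuclideanSpace ℝ (Fin d) => ‖x‖ₑ ^ (-β) := by fun_prop
  rw [lintegral_lintegral_swap (f := fun (p : ℝ≥0 × ℝ≥0) ω => ‖X p.1 ω - X p.2 ω‖ₑ ^ (-β))
    (hf.comp h.measurable_sub).aemeasurable] at hfin
  have hm : Measurable fun ω => ∫⁻ p, ‖X p.1 ω - X p.2 ω‖ₑ ^ (-β) ∂(μ.prod μ) :=
    (hf.comp h.measurable_sub).lintegral_prod_left'
  obtain ⟨ω, hω, hωE⟩ := (hcap.and (ae_lt_top hm hfin)).exists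
  refine absurd hω (pos_iff_ne_zero.1 (fCapacity_pos_iff.2 ?_))
  have hmω : Measurable fun s => X s ω := h.measurable_uncurry.comp measurable_prodMk_right
  refine ⟨μ.map fun s => X s ω, ⟨Measure.isProbabilityMeasure_map hmω.aemeasurable, ?_⟩, ?_⟩
  · rw [imageSet_eq_image]
    exact measure_map_compl_image_eq_zero hmω (measurable_coe_nnreal_real hG) hμG
  · have h2 : Measurable fun q : EuclideanSpace ℝ (Fin d) × EuclideanSpace ℝ (Fin d) =>
      ‖q.1 - q.2‖ₑ ^ (-β) := by fun_prop
    have e : fEnergy (fun x : EuclideanSpace ℝ (Fin d) => ‖x‖ₑ ^ (-β)) (μ.map fun s => X s ω) =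
        ∫⁻ p, ‖X p.1 ω - X p.2 ω‖ₑ ^ (-β) ∂(μ.prod μ) := by
      rw [fEnergy, lintegral_map h2.lintegral_prod_right' hmω, lintegral_prod _ (by fun_prop)]
      exact lintegral_congr fun s => lintegral_map (by fun_prop) hmω
    rw [e]
    exact hωE.ne

/-- Otherwise `exists_mean_energy_ne_top` yields a measure on `G` with finite mean Riesz energy;
adding its negative-part energy, finite by `hneg`, makes its `g_+`-energy finite. -/
theorem ae_rieszCapacity_eq_zero (h : IsRegularLevy X Ψ P) {G : Set ℝ} (hG : MeasurableSet G)
    {β : ℝ} (hβ : 0 < β) (hd : β < d)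
    (hcap : fCapacity (gaugePos Ψ (d - β)) G = 0)
    (hneg : ∀ μ ∈ probOn G,
      ∫⁻ ξ : EuclideanSpace ℝ (Fin d), fEnergy (reChiNeg Ψ ξ) μ * ‖ξ‖ₑ ^ (β - d) < ∞) :
    ∀ᵐ ω ∂P, rieszCapacity β (imageSet X G ω) = 0 := by
  by_contra hne
  have hP : P {ω | ∃ θ ∈ probOn ((fun t => X t ω) '' (((↑) : ℝ≥0 → ℝ) ⁻¹' G)),
      fEnergy (fun x => ‖x‖ₑ ^ (-β)) θ ≠ ∞} ≠ 0 := by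
    intro h0
    refine hne (measure_mono_null (fun ω hω => ?_) h0)
    exact fCapacity_pos_iff.1 (pos_iff_ne_zero.2 hω)
  obtain ⟨μ, hμ, hμG, hfin⟩ := exists_mean_energy_ne_top h.measurable h.right_continuous
    h.indep_increments hβ (fun ε hε => h.continuous_mean_regRiesz hβ hε)
    (measurable_coe_nnreal_real hG) hP
  obtain ⟨c, hc0, -, H⟩ := h.exists_mean_energy_eq hβ hd
  rw [H μ] at hfin
  have hfin' : ∫⁻ ξ : EuclideanSpace ℝ (Fin d),
      ENNReal.ofReal (charFun (meanIncrementLaw X P μ) ξ).re * ‖ξ‖ₑ ^ (β - d) ≠ ∞ := fun h0 =>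
    hfin (by rw [h0, ENNReal.mul_top hc0])
  have hmem := map_coe_mem_probOn hG hμG
  refine absurd hcap (pos_iff_ne_zero.1 (fCapacity_pos_iff.2 ⟨_, hmem, ?_⟩))
  rw [h.fEnergy_gaugePos, neg_sub]
  simp_rw [h.fEnergy_reChiPos_eq μ, add_mul]
  rw [lintegral_add_left]
  · exact ENNReal.add_ne_top.2 ⟨hfin', (hneg _ hmem).ne⟩
  · exact (Complex.measurable_re.comp measurable_charFun).ennreal_ofReal.mul (by fun_prop)

end IsRegularLevy

end Capacities

/-! ### The counterexample `X(t) = t` -/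

section Drift

lemma iIndepFun_const {Ω ι : Type*} {E : ι → Type*} [∀ i, MeasurableSpace (E i)]
    [MeasurableSpace Ω] (P : Measure Ω) [IsProbabilityMeasure P] (c : ∀ i, E i) :
    iIndepFun (fun i (_ : Ω) => c i) P := by
  classical
  rw [iIndepFun_iff_measure_inter_preimage_eq_mul]
  intro S A _
  by_cases h : ∀ i ∈ S, c i ∈ A i
  · have e : ∀ i ∈ S, (fun _ : Ω => c i) ⁻¹' A i = univ := fun i hi => by
      ext; simp [h i hi]
    rw [Finset.prod_congr rfl fun i hi => by rw [e i hi, measure_univ], Finset.prod_const_one,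
      iInter₂_congr e]
    simp
  · push Not at h
    obtain ⟨i, hi, hiA⟩ := h
    have e : (fun _ : Ω => c i) ⁻¹' A i = ∅ := by
      ext; simp [hiA]
    rw [Finset.prod_eq_zero hi (by rw [e, measure_empty])]
    exact measure_mono_null (biInter_subset_of_mem hi) (by rw [e, measure_empty])

lemma continuous_driftProcess (Ω : Type*) (ω : Ω) : Continuous fun t => driftProcess Ω t ω := by
  unfold driftProcess
  fun_prop

lemma driftProcess_add_sub (Ω : Type*) (s t : ℝ≥0) (ω : Ω) :
    driftProcess Ω (s + t) ω - driftProcess Ω s ω = driftProcess Ω t ω := by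
  ext i
  simp [driftProcess]

/-- A uniform translation is a Lévy process. -/
theorem isLevyProcess_driftProcess (Ω : Type*) [MeasurableSpace Ω] (P : Measure Ω)
    [IsProbabilityMeasure P] : IsLevyProcess (driftProcess Ω) P where
  measurable t := measurable_const
  zero := .of_forall fun ω => by ext i; simp [driftProcess]
  indep_increments n t _ := iIndepFun_const P fun i : Fin n =>
    (WithLp.toLp 2 fun _ => ((t i.succ : ℝ≥0) : ℝ) : EuclideanSpace ℝ (Fin 1)) -
      WithLp.toLp 2 fun _ => ((t i.castSucc : ℝ≥0) : ℝ)
  stationary_increments s t := by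
    simp_rw [driftProcess_add_sub]
    exact IdentDistrib.refl measurable_const.aemeasurable
  stochastically_continuous t := by
    intro ε hε
    have h0 : Tendsto (fun _ : ℝ≥0 => (0 : ℝ≥0∞)) (𝓝 t) (𝓝 0) := tendsto_const_nhds
    refine h0.congr' ?_
    have hc (ω : Ω) := (continuous_driftProcess Ω ω).tendsto t
    obtain ⟨ω₀⟩ : Nonempty Ω := P.nonempty_of_neZero
    filter_upwards [(hc ω₀).eventually (Metric.eball_mem_nhds _ hε)] with s hs
    symm
    rw [measure_eq_zero_iff_ae_notMem]
    exact .of_forall fun ω hω => absurd hs (not_lt.2 hω)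
  cadlag := .of_forall fun ω t => ⟨(continuous_driftProcess Ω ω).continuousWithinAt,
    _, ((continuous_driftProcess Ω ω).tendsto t).mono_left nhdsWithin_le_nhds⟩

theorem isLevyExponent_driftExponent (Ω : Type*) [MeasurableSpace Ω] (P : Measure Ω)
    [IsProbabilityMeasure P] : IsLevyExponent driftExponent (driftProcess Ω) P := by
  intro ξ t
  have e : driftProcess Ω t = fun _ => (WithLp.toLp 2 fun _ => (t : ℝ)) := rfl
  rw [e, Measure.map_const, measure_univ, one_smul, charFun_dirac]
  congr 1
  simp only [driftExponent, PiLp.inner_apply, Finset.univ_unique, Finset.sum_singleton]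
  simp
  ring

lemma re_levyChi_driftExponent (ξ : EuclideanSpace ℝ (Fin 1)) (x : ℝ) :
    (levyChi driftExponent ξ x).re = Real.cos (x * ξ 0) := by
  have : levyChi driftExponent ξ x = Complex.exp ((x * ξ 0 : ℝ) * Complex.I) := by
    rcases le_total 0 x with h | h
    · rw [levyChi_of_nonneg h]
      congr 1
      simp only [driftExponent]
      push_cast; ring
    · rw [levyChi_of_nonpos h]
      congr 1
      simp only [driftExponent]
      push_cast [PiLp.neg_apply]; ring
  rw [this, Complex.exp_ofReal_mul_I_re]

/-- On `[-1, 1]` one has `max c 0 ≥ (c + c²) / 2`. Over three angles spaced by `2π / 3` the cosines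
sum to 0 and their squares to `3 / 2`, so the sum is in fact at least `3 / 4`. -/
lemma half_le_sum_max_cos (θ : ℝ) :
    1 / 2 ≤ max (Real.cos θ) 0 + max (Real.cos (θ + 2 * Real.pi / 3)) 0 +
      max (Real.cos (θ + 2 * (2 * Real.pi / 3))) 0 := by
  have key (c : ℝ) (h1 : -1 ≤ c) (h2 : c ≤ 1) : (c + c ^ 2) / 2 ≤ max c 0 := by
    rcases le_total 0 c with h | h
    · rw [max_eq_left h]; nlinarith
    · rw [max_eq_right h]; nlinarith
  have k1 := key _ (Real.neg_one_le_cos θ) (Real.cos_le_one θ)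
  have k2 := key _ (Real.neg_one_le_cos (θ + 2 * Real.pi / 3))
    (Real.cos_le_one (θ + 2 * Real.pi / 3))
  have k3 := key _ (Real.neg_one_le_cos (θ + 2 * (2 * Real.pi / 3)))
    (Real.cos_le_one (θ + 2 * (2 * Real.pi / 3)))
  have c1 : Real.cos (2 * Real.pi / 3) = -(1 / 2) := by
    rw [show 2 * Real.pi / 3 = Real.pi - Real.pi / 3 by ring, Real.cos_pi_sub, Real.cos_pi_div_three]
  have c2 : Real.cos (2 * (2 * Real.pi / 3)) = -(1 / 2) := by
    rw [show 2 * (2 * Real.pi / 3) = Real.pi / 3 + Real.pi by ring, Real.cos_add_pi,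
      Real.cos_pi_div_three]
  have s1 : Real.sin (2 * Real.pi / 3) = √3 / 2 := by
    rw [show 2 * Real.pi / 3 = Real.pi - Real.pi / 3 by ring, Real.sin_pi_sub, Real.sin_pi_div_three]
  have s2 : Real.sin (2 * (2 * Real.pi / 3)) = -(√3 / 2) := by
    rw [show 2 * (2 * Real.pi / 3) = Real.pi / 3 + Real.pi by ring, Real.sin_add_pi,
      Real.sin_pi_div_three]
  rw [Real.cos_add, c1, s1] at k2 ⊢
  rw [Real.cos_add, c2, s2] at k3 ⊢
  have h3 : √3 ^ 2 = 3 := Real.sq_sqrt (by norm_num)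
  have hsc := Real.sin_sq_add_cos_sq θ
  nlinarith

lemma lintegral_Ioi_rpow_add_eq_top {β : ℝ} (hβ : 0 < β) {τ : ℝ} (hτ : 0 ≤ τ) :
    ∫⁻ y in Ioi (0 : ℝ), ENNReal.ofReal ((y + τ) ^ (β - 1)) = ∞ := by
  by_contra h
  have hi : IntegrableOn (fun y : ℝ => (y + τ) ^ (β - 1)) (Ioi 0) := by
    refine ⟨Measurable.aestronglyMeasurable (by fun_prop), ?_⟩
    rw [hasFiniteIntegral_iff_ofReal]
    · exact lt_top_iff_ne_top.2 h
    · filter_upwards [ae_restrict_mem measurableSet_Ioi] with y (hy : 0 < y)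
      simp only [Pi.zero_apply]
      positivity
  have h2 : IntegrableOn (fun y : ℝ => y ^ (β - 1)) (Ioi τ) := by
    have e : (fun y : ℝ => (y + τ) ^ (β - 1)) = (fun y : ℝ => y ^ (β - 1)) ∘ (· + τ) := rfl
    rw [e] at hi
    have := (MeasurePreserving.integrableOn_comp_preimage (measurePreserving_add_right volume τ)
      (MeasurableEquiv.addRight τ).measurableEmbedding (f := fun y : ℝ => y ^ (β - 1))
        (s := Ioi τ)).1
    refine this ?_
    convert hi using 2
    ext y; simp
  have h3 := (integrableOn_Ioi_rpow_iff (by linarith : 0 < τ + 1)).1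
    (h2.mono_set (Ioi_subset_Ioi (by linarith)))
  linarith

/-- The positive part of a cosine is not integrable against a Riesz kernel at infinity. -/
lemma lintegral_max_cos_mul_rpow_eq_top {β : ℝ} (hβ : 0 < β) (hβ1 : β < 1) (x : ℝ) :
    ∫⁻ y in Ioi (0 : ℝ), ENNReal.ofReal (max (Real.cos (x * y)) 0) *
      ENNReal.ofReal (y ^ (β - 1)) = ∞ := by
  wlog hx : 0 ≤ x generalizing x
  · have := this (-x) (by linarith)
    simpa only [neg_mul, Real.cos_neg] using this
  rcases hx.eq_or_lt with rfl | hx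
  · simpa using lintegral_Ioi_rpow_add_eq_top hβ le_rfl
  set τ := 2 * Real.pi / 3 / x with hτ
  have hτ0 : 0 < τ := by positivity
  have hxτ : x * τ = 2 * Real.pi / 3 := by rw [hτ]; field_simp
  set I := ∫⁻ y in Ioi (0 : ℝ), ENNReal.ofReal (max (Real.cos (x * y)) 0) *
      ENNReal.ofReal (y ^ (β - 1)) with hI
  -- Since `β < 1` the power decreases, so each shift by `σ ≤ 2 * τ` can be given the common weight
  -- `(y + 2 * τ) ^ (β - 1)`. The shifts by `0`, `τ`, `2 * τ` then add up to at least half of a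
  -- divergent integral.
  have hshift (σ : ℝ) (h0 : 0 ≤ σ) (h2 : σ ≤ 2 * τ) :
      ∫⁻ y in Ioi (0 : ℝ), ENNReal.ofReal (max (Real.cos (x * y + x * σ)) 0) *
        ENNReal.ofReal ((y + 2 * τ) ^ (β - 1)) ≤ I := by
    calc _ ≤ ∫⁻ y in Ioi (0 : ℝ), ENNReal.ofReal (max (Real.cos (x * (y + σ))) 0) *
          ENNReal.ofReal ((y + σ) ^ (β - 1)) := by
          refine setLIntegral_mono' measurableSet_Ioi fun y (hy : 0 < y) => ?_
          rw [mul_add]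
          refine mul_le_mul_right (ENNReal.ofReal_le_ofReal ?_) _
          exact Real.rpow_le_rpow_of_nonpos (by positivity) (by linarith) (by linarith)
      _ = ∫⁻ y in Ioi σ, ENNReal.ofReal (max (Real.cos (x * y)) 0) *
          ENNReal.ofReal (y ^ (β - 1)) := by
          rw [← (measurePreserving_add_right volume σ).setLIntegral_comp_preimage (s := Ioi σ)
            (f := fun y => ENNReal.ofReal (max (Real.cos (x * y)) 0) *
              ENNReal.ofReal (y ^ (β - 1))) measurableSet_Ioi (by fun_prop)]
          congr 2
          ext y; simp
      _ ≤ I := lintegral_mono_set (Ioi_subset_Ioi h0)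
  have hsum : ENNReal.ofReal (1 / 2) * ∫⁻ y in Ioi (0 : ℝ),
      ENNReal.ofReal ((y + 2 * τ) ^ (β - 1)) ≤ I + I + I := by
    refine le_trans ?_ (add_le_add (add_le_add (hshift 0 le_rfl (by positivity))
      (hshift τ hτ0.le (by linarith))) (hshift (2 * τ) (by positivity) le_rfl))
    rw [← lintegral_const_mul' _ _ ENNReal.ofReal_ne_top, ← lintegral_add_left (by fun_prop),
      ← lintegral_add_left (by fun_prop)]
    refine lintegral_mono fun y => ?_
    rw [← add_mul, ← add_mul]
    gcongr
    rw [← ENNReal.ofReal_add (le_max_right _ _) (le_max_right _ _),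
      ← ENNReal.ofReal_add (by positivity) (le_max_right _ _)]
    refine ENNReal.ofReal_le_ofReal ?_
    have := half_le_sum_max_cos (x * y)
    rw [mul_zero, add_zero, mul_left_comm, hxτ]
    exact this
  rw [lintegral_Ioi_rpow_add_eq_top hβ (by positivity), ENNReal.mul_top (by simp), top_le_iff]
    at hsum
  simpa using hsum

/-- The coordinate on one-dimensional Euclidean space preserves volume. -/
lemma measurePreserving_euclidean_one :
    MeasurePreserving fun y : ℝ => (WithLp.toLp 2 fun _ => y : EuclideanSpace ℝ (Fin 1)) := by
  have h1 := (volume_preserving_funUnique (Fin 1) ℝ).symm (MeasurableEquiv.funUnique (Fin 1) ℝ)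
  exact (PiLp.volume_preserving_toLp (Fin 1)).comp h1

lemma norm_euclidean_one (y : ℝ) :
    ‖(WithLp.toLp 2 fun _ => y : EuclideanSpace ℝ (Fin 1))‖ = |y| := by
  simp [EuclideanSpace.norm_eq, Real.sqrt_sq_eq_abs]

lemma gaugePos_driftExponent_eq_top {β : ℝ} (hβ : 0 < β) (hβ1 : β < 1) (x : ℝ) :
    gaugePos driftExponent (1 - β) x = ∞ := by
  have hm : Measurable fun ξ : EuclideanSpace ℝ (Fin 1) =>
      reChiPos driftExponent ξ x * ‖ξ‖ₑ ^ (-(1 - β)) := by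
    simp only [reChiPos, re_levyChi_driftExponent]
    fun_prop
  rw [gaugePos, ← measurePreserving_euclidean_one.lintegral_comp hm, ← top_le_iff,
    ← lintegral_max_cos_mul_rpow_eq_top hβ hβ1 x]
  refine le_trans (le_of_eq ?_) (setLIntegral_le_lintegral (Ioi (0 : ℝ)) _)
  refine setLIntegral_congr_fun measurableSet_Ioi fun y (hy : 0 < y) => ?_
  simp only [reChiPos, re_levyChi_driftExponent]
  rw [← ofReal_norm, norm_euclidean_one, abs_of_pos hy, ENNReal.ofReal_rpow_of_pos hy, neg_sub]

theorem fCapacity_gaugePos_driftExponent {β : ℝ} (hβ : 0 < β) (hβ1 : β < 1) (A : Set ℝ) :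
    fCapacity (gaugePos driftExponent (1 - β)) A = 0 := by
  rw [← nonpos_iff_eq_zero, ← not_lt, fCapacity_pos_iff]
  rintro ⟨μ, ⟨hμ, -⟩, hE⟩
  refine hE ?_
  simp [fEnergy, gaugePos_driftExponent_eq_top hβ hβ1]

/-- A nondegenerate segment has positive capacity of every order less than one. -/
theorem rieszCapacity_imageSet_driftProcess_pos {Ω : Type*} (ω : Ω) {β : ℝ} (hβ : 0 < β)
    (hβ1 : β < 1) : 0 < rieszCapacity β (imageSet (driftProcess Ω) (Icc 0 1) ω) := by
  let f : ℝ → EuclideanSpace ℝ (Fin 1) := fun y => WithLp.toLp 2 fun _ => y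
  have hf : Continuous f := by fun_prop
  have himage : imageSet (driftProcess Ω) (Icc 0 1) ω = f '' Icc 0 1 := by
    ext v
    constructor
    · rintro ⟨t, ht, rfl⟩
      exact ⟨t, ht, rfl⟩
    · rintro ⟨y, hy, rfl⟩
      exact ⟨⟨y, hy.1⟩, hy, rfl⟩
  rw [himage]
  refine fCapacity_pos_iff.2 ⟨(volume.restrict (Icc (0 : ℝ) 1)).map f, ⟨?_, ?_⟩, ?_⟩
  · have : IsProbabilityMeasure (volume.restrict (Icc (0 : ℝ) 1)) := ⟨by simp⟩
    exact Measure.isProbabilityMeasure_map hf.aemeasurable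
  · rw [Measure.map_apply hf.measurable (isCompact_Icc.image hf).measurableSet.compl]
    refine measure_mono_null (t := (Icc (0 : ℝ) 1)ᶜ)
      (fun y hy hy' => hy (mem_image_of_mem f hy')) ?_
    rw [Measure.restrict_apply measurableSet_Icc.compl]
    simp
  -- Differences of points of `[0, 1]` lie in the ball of radius 2, so every inner potential is
  -- bounded by this integral, finite because `β < 1`.
  · have hfin : ∫⁻ z in Metric.ball (0 : ℝ) 2, ‖z‖ₑ ^ (-β) ≠ ∞ := by
      have h1 : IntegrableOn (fun z : ℝ => ‖z‖ ^ (-β)) (Metric.ball 0 2) := by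
        refine integrableOn_ball_of_norm_le_rpow (C := 1) (α := β) (by simp) (by simpa using hβ1)
          (.of_forall fun z => ?_) (Measurable.aestronglyMeasurable (by fun_prop))
        rw [one_mul, Real.norm_of_nonneg (by positivity)]
      have h2 := (hasFiniteIntegral_iff_ofReal (.of_forall fun z => by positivity)).1 h1.2
      refine (lt_of_eq_of_lt (lintegral_congr_ae ?_) h2).ne
      filter_upwards [ae_restrict_of_ae (Measure.ae_ne volume (0 : ℝ))] with z hz
      rw [← ofReal_norm, ENNReal.ofReal_rpow_of_pos (norm_pos_iff.2 hz)]
    have h2 : Measurable fun q : EuclideanSpace ℝ (Fin 1) × EuclideanSpace ℝ (Fin 1) =>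
      ‖q.1 - q.2‖ₑ ^ (-β) := by fun_prop
    have hsub (x y : ℝ) : ‖f x - f y‖ₑ = ‖x - y‖ₑ := by
      have : f x - f y = f (x - y) := by ext i; simp [f]
      rw [this, ← ofReal_norm, ← ofReal_norm, norm_euclidean_one, Real.norm_eq_abs]
    rw [fEnergy, lintegral_map h2.lintegral_prod_right' hf.measurable]
    have hbound : ∀ x ∈ Icc (0 : ℝ) 1,
        ∫⁻ y, ‖f x - y‖ₑ ^ (-β) ∂(volume.restrict (Icc (0 : ℝ) 1)).map f ≤
          ∫⁻ z in Metric.ball (0 : ℝ) 2, ‖z‖ₑ ^ (-β) := fun x hx => by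
      rw [lintegral_map (by fun_prop) hf.measurable]
      simp_rw [hsub]
      rw [← (Measure.measurePreserving_sub_left (volume : Measure ℝ) x).setLIntegral_comp_preimage
        (s := Metric.ball 0 2) (f := fun z => ‖z‖ₑ ^ (-β)) Metric.isOpen_ball.measurableSet
        (by fun_prop)]
      refine lintegral_mono_set fun y hy => ?_
      simp only [mem_preimage, Metric.mem_ball, dist_zero_right, Real.norm_eq_abs]
      rw [abs_lt]
      constructor <;> linarith [hx.1, hx.2, hy.1, hy.2]
    refine ne_top_of_le_ne_top hfin ((setLIntegral_mono' measurableSet_Icc hbound).trans ?_)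
    simp

end Drift

/-! ### Assembly of the theorem -/

theorem theorem2p1 :
    (∀ (d : ℕ) (Ω : Type*) [MeasurableSpace Ω] (P : Measure Ω) [IsProbabilityMeasure P]
        (X : ℝ≥0 → Ω → EuclideanSpace ℝ (Fin d)) (Ψ : EuclideanSpace ℝ (Fin d) → ℂ),
        IsLevyProcess X P → IsLevyExponent Ψ X P →
        ∀ G : Set ℝ, MeasurableSet G → G ⊆ Ici 0 → ∀ β : ℝ, 0 < β → β < d →
          -- part (a)
          (0 < fCapacity (gaugePos Ψ (d - β)) G → 0 < fCapacity (gaugeNeg Ψ (d - β)) G) ∧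
          -- part (b)
          (fCapacity (gaugeNeg Ψ (d - β)) G = 0 → fCapacity (gaugePos Ψ (d - β)) G = 0) ∧
          -- part (c)
          ((∀ᵐ ω ∂P, rieszCapacity β (imageSet X G ω) = 0) →
            fCapacity (gaugePos Ψ (d - β)) G = 0) ∧
          -- part (e)
          (fCapacity (gaugePos Ψ (d - β)) G = 0 →
            (∀ μ ∈ probOn G,
              ∫⁻ ξ : EuclideanSpace ℝ (Fin d), fEnergy (reChiNeg Ψ ξ) μ * ‖ξ‖ₑ ^ (β - d) < ∞) →
            ∀ᵐ ω ∂P, rieszCapacity β (imageSet X G ω) = 0)) ∧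
    -- part (d): the converse of (c) fails for `X(t) = t`, `G = [0, 1]` and every `β ∈ (0, 1)`
    (∀ (Ω : Type*) [MeasurableSpace Ω] (P : Measure Ω) [IsProbabilityMeasure P],
        IsLevyProcess (driftProcess Ω) P ∧ IsLevyExponent driftExponent (driftProcess Ω) P ∧
        ∀ β : ℝ, 0 < β → β < 1 →
          fCapacity (gaugePos driftExponent (1 - β)) (Icc 0 1) = 0 ∧
          ¬ ∀ᵐ ω ∂P, rieszCapacity β (imageSet (driftProcess Ω) (Icc 0 1) ω) = 0) := by
  refine ⟨fun d Ω _ P _ X Ψ hX hΨ G hG hG0 β hβ hd => ?_, fun Ω _ P _ => ?_⟩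
  · obtain ⟨Y, hY, hYX⟩ := hX.exists_regular hΨ
    have hpos := hY.fCapacity_gaugeNeg_pos (γ := d - β) hG hG0
    refine ⟨hpos, fun h => ?_, fun h => ?_, fun h hneg => ?_⟩
    · by_contra hne
      exact (hpos (pos_iff_ne_zero.2 hne)).ne' h
    · refine hY.fCapacity_gaugePos_eq_zero hG hG0 hβ hd ?_
      filter_upwards [h, hYX] with ω hω he
      rwa [← imageSet_congr he]
    · filter_upwards [hY.ae_rieszCapacity_eq_zero hG hβ hd h hneg, hYX] with ω hω he
      rwa [imageSet_congr he]
  · refine ⟨isLevyProcess_driftProcess Ω P, isLevyExponent_driftExponent Ω P,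
      fun β hβ hβ1 => ⟨fCapacity_gaugePos_driftExponent hβ hβ1 _, fun h => ?_⟩⟩
    obtain ⟨ω, hω⟩ := h.exists
    exact (rieszCapacity_imageSet_driftProcess_pos ω hβ hβ1).ne' hω
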